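/- Let $\mathbb{T}$ be the triangular lattice: the graph on $\mathbb{Z}^2$ in which $u,v$ are adjacent when $v-u$ or $u-v$ lies in $\{(1,0),(0,1),(1,1)\}$. A domain $\mathsf{R}\subset\mathbb{T}$ is a finite simply connected induced subgraph, and its boundary $\partial\mathsf{R}$ is the set of vertices of $\mathsf{R}$ adjacent to a vertex of $\mathbb{T}\setminus\mathsf{R}$. A height function on $\mathsf{R}$ is a function $\mathsf{H}:\mathsf{R}\to\mathbb{Z}$ with $\mathsf{H}(v)-\mathsf{H}(u)\in\{0,1\}$ whenever $u=(x,y)\in\mathsf{R}$ and $v\in\{(x+1,y),(x,y-1),(x+1,y+1)\}\cap\mathsf{R}$. For $\mathsf{h}:\partial\mathsf{R}\to\mathbb{Z}$ let $\mathscr{G}(\mathsf{h})$ be the set of height functions $\mathsf{H}$ on $\mathsf{R}$ with $\mathsf{H}|_{\partial\mathsf{R}}=\mathsf{h}$. Fix a domain $\mathsf{R}$, a function $\mathsf{h}:\partial\mathsf{R}\to\mathbb{Z}$ with $\mathscr{G}(\mathsf{h})\neq\emptyset$, an integer $k\ge 1$, and domains $\mathsf{R}_1,\dots,\mathsf{R}_k\subseteq\mathsf{R}$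 with $\mathsf{R}=\bigcup_{i=1}^k\mathsf{R}_i$, such that each $v\in\mathsf{R}\setminus\partial\mathsf{R}$ lies in $\mathsf{R}_i\setminus\partial\mathsf{R}_i$ for some $i$. The alternating dynamics $M_{\mathrm{alt}}$ is the discrete-time Markov chain on $\mathscr{G}(\mathsf{h})$ whose state $\mathsf{H}_t$ at time $t\ge1$ is obtained from $\mathsf{H}_{t-1}$ as follows: let $i\in[1,k]$ be such that $k$ divides $t-i$, let $\mathsf{F}_t$ be a uniformly random element of $\mathscr{G}(\mathsf{H}_{t-1}|_{\partial\mathsf{R}_i})$ (a height function on $\mathsf{R}_i$), and set $\mathsf{H}_t=\mathsf{F}_t$ on $\mathsf{R}_i$ and $\mathsf{H}_t=\mathsf{H}_{t-1}$ on $\mathsf{R}\setminus\mathsf{R}_i$. For probability measures on $\mathscr{G}(\mathsf{h})$ let $d_{\mathrm{TV}}(\nu,\nu')=\max_{B\subseteq\mathscr{G}(\mathsf{h})}|\nu(B)-\nu'(B)|$, let $M_{\mathrm{alt}}^t\nu$ be the law of the chain at time $t$ when its initial law is $\nu$, and call a probability measure stationary if it is preserved by every step of the chain. For $\varepsilon>0$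 let $$t_{\mathrm{mix}}(\varepsilon;M_{\mathrm{alt}})=\min\Big\{t\in\mathbb{Z}_{\ge0}:\max_{\nu}d_{\mathrm{TV}}(M_{\mathrm{alt}}^t\nu,\rho)<\varepsilon\Big\},$$ where $\rho$ is the stationary measure and $\nu$ ranges over all probability measures on $\mathscr{G}(\mathsf{h})$. **Proposition.** There is an absolute constant $C>1$ such that the following holds for all such $\mathsf{R},\mathsf{h},k,\mathsf{R}_1,\dots,\mathsf{R}_k$. Let $A=(\operatorname{diam}\mathsf{R})^2$, where $\operatorname{diam}$ is the Euclidean diameter of $\mathsf{R}\subset\mathbb{Z}^2\subset\mathbb{R}^2$. If $A\ge C$ and $k\le A$, then the uniform measure $\rho$ on $\mathscr{G}(\mathsf{h})$ is the unique stationary measure of $M_{\mathrm{alt}}$, and $t_{\mathrm{mix}}(e^{-A};M_{\mathrm{alt}})\le A^6$. -/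

import Mathlib

open scoped Classical

noncomputable section

namespace Lozenge

/-! ## The triangular lattice, domains, and height functions -/

/-- The triangular lattice `𝕋`: vertex set `ℤ²`, with `u`, `v` adjacent when `v - u` or `u - v` is
one of `(1, 0)`, `(0, 1)`, `(1, 1)`. -/
def triLattice : SimpleGraph (ℤ × ℤ) where
  Adj u v := (v - u = (1, 0) ∨ v - u = (0, 1) ∨ v - u = (1, 1)) ∨
    (u - v = (1, 0) ∨ u - v = (0, 1) ∨ u - v = (1, 1))
  symm := ⟨fun _ _ h => Or.symm h⟩
  loopless := ⟨fun u h => by simp [Prod.ext_iff] at h⟩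

/-- A (finite) domain: a simply connected induced subgraph of `𝕋`, given by its vertex set.
The union of the vertices, edges and triangular faces of `𝕋` that are spanned by vertices of `R`
is a compact planar set whose complement retracts onto the corresponding set for `Rᶜ`;
it is simply connected exactly when it is connected and has no holes, that is, when the subgraphs
of `𝕋` induced on `R` and on its complement are both connected (in particular `R` is nonempty). -/
structure IsLatticeDomain (R : Finset (ℤ × ℤ)) : Prop where
  connected : (triLattice.induce (R : Set (ℤ × ℤ))).Connected
  compl_connected : (triLattice.induce ((R : Set (ℤ × ℤ))ᶜ)).Connected

/-- The boundary `∂R`: the vertices of `R` that are adjacent to a vertex of `𝕋` outside `R`. -/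
def boundary (R : Finset (ℤ × ℤ)) : Finset (ℤ × ℤ) :=
  R.filter fun v => ∃ w, w ∉ R ∧ triLattice.Adj v w

lemma boundary_subset (R : Finset (ℤ × ℤ)) : boundary R ⊆ R := Finset.filter_subset _ _

/-- `H : R → ℤ` is a height function: `H v - H u ∈ {0, 1}` whenever `u = (x, y)` and `v` is one of
`(x + 1, y)`, `(x, y - 1)`, `(x + 1, y + 1)`, for `u`, `v` in `R`. -/
def IsHeight {R : Finset (ℤ × ℤ)} (H : R → ℤ) : Prop :=
  ∀ u v : R, ((v : ℤ × ℤ) = (u : ℤ × ℤ) + (1, 0) ∨ (v : ℤ × ℤ) = (u : ℤ × ℤ) + (0, -1) ∨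
    (v : ℤ × ℤ) = (u : ℤ × ℤ) + (1, 1)) → H v - H u = 0 ∨ H v - H u = 1

/-- `𝒢(h)`: the height functions on `R` whose restriction to `∂R` is `h`. -/
def HeightFun (R : Finset (ℤ × ℤ)) (h : boundary R → ℤ) : Type :=
  {H : R → ℤ // IsHeight H ∧ ∀ v : boundary R, H ⟨v, boundary_subset R v.2⟩ = h v}

/-- The set `𝒢(h)` is finite: going in the direction `(1, 0)` from a vertex of `R` one reaches `∂R`,
and the height changes by `0` or `1` in each step. -/
instance finite_heightFun (R : Finset (ℤ × ℤ)) (h : boundary R → ℤ) :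
    Finite (HeightFun R h) := by
  obtain ⟨M, hM⟩ : ∃ M : ℤ, ∀ v ∈ R, v.1 ≤ M := by
    obtain ⟨M, hM⟩ := (R.image Prod.fst).bddAbove
    exact ⟨M, fun v hv => hM (by simpa using ⟨v.2, hv⟩)⟩
  have key : ∀ n : ℕ, ∀ v : R, (M - (v : ℤ × ℤ).1).toNat ≤ n →
      (Set.range fun H : HeightFun R h => H.1 v).Finite := by
    intro n
    induction n with
    | zero =>
      intro v hv
      have hle := hM v v.2
      have hvb : (v : ℤ × ℤ) ∈ boundary R := by
        refine Finset.mem_filter.2 ⟨v.2, (v : ℤ × ℤ) + (1, 0), fun hw => ?_, Or.inl (Or.inl (by simp))⟩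
        have := hM _ hw
        simp only [Prod.fst_add] at this
        omega
      refine (Set.finite_singleton (h ⟨v, hvb⟩)).subset ?_
      rintro _ ⟨H, rfl⟩
      exact H.2.2 ⟨v, hvb⟩
    | succ n ih =>
      intro v hv
      have hle := hM v v.2
      by_cases hw : (v : ℤ × ℤ) + (1, 0) ∈ R
      · have hfin := ih ⟨_, hw⟩ (by simp only [Prod.fst_add]; omega)
        refine (hfin.union (hfin.image fun z => z - 1)).subset ?_
        rintro _ ⟨H, rfl⟩
        rcases H.2.1 v ⟨_, hw⟩ (Or.inl rfl) with h0 | h1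
        · exact Or.inl ⟨H, by simp only; omega⟩
        · exact Or.inr ⟨_, ⟨H, rfl⟩, by simp only; omega⟩
      · have hvb : (v : ℤ × ℤ) ∈ boundary R :=
          Finset.mem_filter.2 ⟨v.2, (v : ℤ × ℤ) + (1, 0), hw, Or.inl (Or.inl (by simp))⟩
        refine (Set.finite_singleton (h ⟨v, hvb⟩)).subset ?_
        rintro _ ⟨H, rfl⟩
        exact H.2.2 ⟨v, hvb⟩
  have hpi : {f : R → ℤ | ∀ v, f v ∈ Set.range fun H : HeightFun R h => H.1 v}.Finite :=
    Set.Finite.pi' fun v => key _ v le_rfl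
  have hfin : {H : R → ℤ | IsHeight H ∧
      ∀ v : boundary R, H ⟨v, boundary_subset R v.2⟩ = h v}.Finite :=
    hpi.subset fun H hH v => ⟨⟨H, hH⟩, rfl⟩
  exact hfin

instance fintype_heightFun (R : Finset (ℤ × ℤ)) (h : boundary R → ℤ) :
    Fintype (HeightFun R h) := Fintype.ofFinite _

/-- The diameter of `R ⊂ ℤ² ⊂ ℝ²` in the Euclidean distance. -/
def latticeDiam (R : Finset (ℤ × ℤ)) : ℝ :=
  Metric.diam ((fun v : ℤ × ℤ => (!₂[(v.1 : ℝ), (v.2 : ℝ)] : EuclideanSpace ℝ (Fin 2))) ''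
    (R : Set (ℤ × ℤ)))

/-! ## Resampling on a subdomain -/

section Resample

variable {R Q : Finset (ℤ × ℤ)} {h : boundary R → ℤ}

/-- The boundary data `H|_{∂Q}` of a height function `H` on `R ⊇ Q`. -/
def boundaryRestrict (hQ : Q ⊆ R) (H : HeightFun R h) : boundary Q → ℤ :=
  fun v => H.1 ⟨v, hQ (boundary_subset Q v.2)⟩

/-- The restriction `H|_Q ∈ 𝒢(H|_{∂Q})`. -/
def restrict (hQ : Q ⊆ R) (H : HeightFun R h) : HeightFun Q (boundaryRestrict hQ H) :=
  ⟨fun v => H.1 ⟨v, hQ v.2⟩, fun _ _ huv => H.2.1 _ _ huv, fun _ => rfl⟩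

instance nonempty_restrict (hQ : Q ⊆ R) (H : HeightFun R h) :
    Nonempty (HeightFun Q (boundaryRestrict hQ H)) := ⟨restrict hQ H⟩

lemma adj_of_step {u v : ℤ × ℤ} (huv : v = u + (1, 0) ∨ v = u + (0, -1) ∨ v = u + (1, 1)) :
    triLattice.Adj u v := by
  rcases huv with rfl | rfl | rfl
  · exact Or.inl (Or.inl (by simp))
  · exact Or.inr (Or.inr (Or.inl (by simp)))
  · exact Or.inl (Or.inr (Or.inr (by simp)))

/-- The function equal to `F` on `Q` and to `H` on `R \ Q`. -/
def glueFun (H : HeightFun R h) (F : Q → ℤ) : R → ℤ :=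
  fun v => if hv : (v : ℤ × ℤ) ∈ Q then F ⟨v, hv⟩ else H.1 v

/-- If `F` agrees with `H` on `∂Q`, then gluing yields an element of `𝒢(h)`. -/
def glue (hQ : Q ⊆ R) (H : HeightFun R h) (F : HeightFun Q (boundaryRestrict hQ H)) :
    HeightFun R h := by
  refine ⟨glueFun H F.1, ?_, ?_⟩
  · intro u v huv
    have hadj := adj_of_step huv
    unfold glueFun
    by_cases hu : (u : ℤ × ℤ) ∈ Q <;> by_cases hv : (v : ℤ × ℤ) ∈ Q
    · rw [dif_pos hu, dif_pos hv]
      exact F.2.1 ⟨u, hu⟩ ⟨v, hv⟩ huv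
    · have hub : (u : ℤ × ℤ) ∈ boundary Q := Finset.mem_filter.2 ⟨hu, v, hv, hadj⟩
      have hF : F.1 ⟨u, hu⟩ = H.1 u := F.2.2 ⟨u, hub⟩
      rw [dif_pos hu, dif_neg hv, hF]
      exact H.2.1 u v huv
    · have hvb : (v : ℤ × ℤ) ∈ boundary Q := Finset.mem_filter.2 ⟨hv, u, hu, hadj.symm⟩
      have hF : F.1 ⟨v, hv⟩ = H.1 v := F.2.2 ⟨v, hvb⟩
      rw [dif_neg hu, dif_pos hv, hF]
      exact H.2.1 u v huv
    · rw [dif_neg hu, dif_neg hv]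
      exact H.2.1 u v huv
  · intro v
    unfold glueFun
    by_cases hv : (v : ℤ × ℤ) ∈ Q
    · obtain ⟨_, w, hw, hadj⟩ := Finset.mem_filter.1 v.2
      have hvb : (v : ℤ × ℤ) ∈ boundary Q :=
        Finset.mem_filter.2 ⟨hv, w, fun hwQ => hw (hQ hwQ), hadj⟩
      have hF : F.1 ⟨v, hv⟩ = H.1 ⟨v, boundary_subset R v.2⟩ := F.2.2 ⟨v, hvb⟩
      rw [dif_pos hv, hF]
      exact H.2.2 v
    · rw [dif_neg hv]
      exact H.2.2 v

/-- One resampling step on `Q ⊆ R`: given the state `H`, draw `F ∈ 𝒢(H|_{∂Q})` uniformly at random;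
the new state is `F` on `Q` and `H` on `R \ Q`. -/
def resample (hQ : Q ⊆ R) (H : HeightFun R h) : PMF (HeightFun R h) :=
  (PMF.uniformOfFintype (HeightFun Q (boundaryRestrict hQ H))).map (glue hQ H)

end Resample

/-! ## Markov chains and mixing times -/

section Markov

variable {S : Type}

/-- The law after `t` steps of the Markov chain on `S` with initial law `ν` whose step from time
`t - 1` to time `t` is given by the transition probabilities `M t`. -/
def lawAt (M : ℕ → S → PMF S) (ν : PMF S) : ℕ → PMF S
  | 0 => ν
  | t + 1 => (lawAt M ν t).bind (M (t + 1))

/-- `ρ` is stationary: it is preserved by every step of the chain. -/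
def IsStationary (M : ℕ → S → PMF S) (ρ : PMF S) : Prop :=
  ∀ t : ℕ, 1 ≤ t → ρ.bind (M t) = ρ

/-- The total variation distance `max_B |ν(B) - ν'(B)|`. -/
def dTV (ν ν' : PMF S) : ℝ :=
  ⨆ B : Set S, |(ν.toOuterMeasure B).toReal - (ν'.toOuterMeasure B).toReal|

/-- The mixing time of the chain with respect to the law `ρ`: the least `t` such that
`max_ν d_TV(M^t ν, ρ) < ε`, the maximum being over all initial laws `ν` (and `⊤` if there is no
such `t`). -/
def mixingTime (M : ℕ → S → PMF S) (ρ : PMF S) (ε : ℝ) : ℕ∞ :=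
  sInf {n : ℕ∞ | ∃ t : ℕ, n = t ∧ (⨆ ν : PMF S, dTV (lawAt M ν t) ρ) < ε}

end Markov

/-- The alternating dynamics on `𝒢(h)` with respect to the subdomains `Q 0, …, Q (k - 1)`
of `R` (numbered from `0` rather than from `1`): step `t ≥ 1` resamples on `Q i`, where
`0 ≤ i < k` and `k` divides `t - (i + 1)`. -/
def alternating {R : Finset (ℤ × ℤ)} {h : boundary R → ℤ} {k : ℕ} (hk : 1 ≤ k)
    (Q : Fin k → Finset (ℤ × ℤ)) (hQ : ∀ i, Q i ⊆ R) (t : ℕ) :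
    HeightFun R h → PMF (HeightFun R h) :=
  resample (hQ ⟨(t - 1) % k, Nat.mod_lt _ hk⟩)

end Lozenge

end

/-! Resampling on a subdomain replaces the density of the law by its conditional expectation, under
the uniform measure, given the heights outside the interior of the subdomain (`dens_bind_resample`).
Each step is thus an orthogonal projection in `ℓ²`, and one round of the dynamics is a product of
`k` projections applied to a mean-zero function, the deviation from the uniform density.

The quantitative input is a Poincaré inequality for single-site resampling, `sqn_le_of_forall_site`.
It is obtained in two stages, resampling whole columns of the domain (`column_gap`) and then single
sites inside a column (`site_gap`). In both stages the blocks lie on a line, and two height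
functions differing by one at a vertex `v` are compared. Resampling the block of `v` removes the
difference, a distant block does not affect it, and each of the two adjacent blocks increases the
effect on a test function by at most half of the effect of a single-site change in that block. With
the concave weight `(j - lo) * (hi - j)` on block `j`, whose discrete Laplacian is `-2`, the sum of
the averaging operators contracts a weighted Lipschitz seminorm (`ladder_gap`). This bounds its
eigenvalues, hence its quadratic form (`gap_of_contraction`). The factor one half for columns is the
combinatorial heart of the argument (`abs_ave_sub_ave_end_of_run`, `column_coupling`).

Every interior site lies in the interior of some subdomain, so the Poincaré inequality shows that
some projection of the round moves the deviation by a definite proportion. A sequence of `k`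
projections then loses a proportion `16 / (A ^ 3 * k)` of the squared norm
(`sqn_sub_cexp_le_of_iterate`, `sqn_deviation_round`). The state space has at most `exp (4 * A)`
elements, so about `A ^ 6 / k` rounds suffice. -/

noncomputable section

namespace Lozenge

/-! ## Averages over the classes of an equivalence relation on a finite set -/

section Averaging

variable {Ω : Type}

/-- The average of `f` over the finite set `s`. -/
def ave (s : Finset Ω) (f : Ω → ℝ) : ℝ := (∑ ω ∈ s, f ω) / s.card

lemma ave_of_const {s : Finset Ω} (hs : s.Nonempty) {f : Ω → ℝ} {c : ℝ} (h : ∀ ω ∈ s, f ω = c) :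
    ave s f = c := by
  have : (0 : ℝ) < s.card := by exact_mod_cast hs.card_pos
  rw [ave, Finset.sum_congr rfl h, Finset.sum_const, nsmul_eq_mul]
  field_simp

variable [Fintype Ω]

/-- The class of `ω`. -/
def cls (r : Setoid Ω) (ω : Ω) : Finset Ω := Finset.univ.filter fun ω' => r.r ω ω'

/-- The conditional expectation of `f`, under the uniform measure, given the class. -/
def cexp (r : Setoid Ω) (f : Ω → ℝ) (ω : Ω) : ℝ := ave (cls r ω) f

/-- The square of the `ℓ²` norm. -/
def sqn (f : Ω → ℝ) : ℝ := ∑ ω, f ω ^ 2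

variable (r t : Setoid Ω) (f g : Ω → ℝ)

lemma sqn_nonneg : 0 ≤ sqn f := Finset.sum_nonneg fun _ _ => sq_nonneg _

lemma mem_cls {ω ω' : Ω} : ω' ∈ cls r ω ↔ r.r ω ω' := by simp [cls]

lemma self_mem_cls (ω : Ω) : ω ∈ cls r ω := (mem_cls r).2 (r.iseqv.refl ω)

variable {r t} in
lemma cls_congr {ω ω' : Ω} (h : r.r ω ω') : cls r ω = cls r ω' := by
  ext x
  simp only [mem_cls]
  exact ⟨fun hx => r.iseqv.trans (r.iseqv.symm h) hx, fun hx => r.iseqv.trans h hx⟩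

variable {r t} in
lemma cexp_congr {ω ω' : Ω} (h : r.r ω ω') : cexp r f ω = cexp r f ω' := by
  rw [cexp, cexp, cls_congr h]

variable {r f} in
lemma cexp_eq_self (h : ∀ ω ω', r.r ω ω' → f ω' = f ω) : cexp r f = f := by
  ext ω
  exact ave_of_const ⟨ω, self_mem_cls r ω⟩ fun ω' hω' => h _ _ ((mem_cls r).1 hω')

lemma cexp_sub : cexp r (f - g) = cexp r f - cexp r g := by
  ext ω
  simp [cexp, ave, Finset.sum_sub_distrib, sub_div]

lemma cexp_add : cexp r (f + g) = cexp r f + cexp r g := by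
  ext ω
  simp [cexp, ave, Finset.sum_add_distrib, add_div]

lemma cexp_smul (c : ℝ) : cexp r (c • f) = c • cexp r f := by
  ext ω
  simp [cexp, ave, ← Finset.mul_sum, mul_div_assoc]

/-- The conditional expectation as a linear map. -/
def cexpₗ : (Ω → ℝ) →ₗ[ℝ] (Ω → ℝ) where
  toFun := cexp r
  map_add' := cexp_add r
  map_smul' := fun c f => cexp_smul r f c

lemma cexp_sum {ι : Type*} (s : Finset ι) (F : ι → Ω → ℝ) :
    cexp r (∑ i ∈ s, F i) = ∑ i ∈ s, cexp r (F i) := by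
  ext ω
  simp only [cexp, ave, Finset.sum_apply]
  rw [Finset.sum_comm, Finset.sum_div]

/-- Self-adjointness: the averaging kernel is symmetric because related points have the same class,
hence the same normalisation. -/
lemma sum_mul_cexp : ∑ ω, g ω * cexp r f ω = ∑ ω, cexp r g ω * f ω := by
  simp only [cexp, ave, Finset.mul_sum, Finset.sum_mul, Finset.sum_div, mul_div_assoc', div_mul_eq_mul_div, cls, Finset.sum_filter]
  rw [Finset.sum_comm]
  refine Finset.sum_congr rfl fun ω _ => Finset.sum_congr rfl fun ω' _ => ?_
  by_cases h : r.r ω ω'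
  · have h' := r.iseqv.symm h
    have e := cls_congr h
    simp only [cls] at e
    rw [if_pos h, if_pos h', e]
  · have h' : ¬ r.r ω' ω := fun h' => h (r.iseqv.symm h')
    rw [if_neg h, if_neg h']
    simp

lemma cexp_cexp_of_le (h : r ≤ t) : cexp r (cexp t f) = cexp t f :=
  cexp_eq_self fun _ _ hω => (cexp_congr f (h hω)).symm

/-- The tower property, dual to `cexp_cexp_of_le` by self-adjointness and tested against point
masses. -/
lemma cexp_cexp_of_ge (h : r ≤ t) : cexp t (cexp r f) = cexp t f := by
  have key : ∀ g : Ω → ℝ, ∑ ω, g ω * cexp t (cexp r f) ω = ∑ ω, g ω * cexp t f ω := fun g => by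
    rw [sum_mul_cexp, sum_mul_cexp, cexp_cexp_of_le r t g h, ← sum_mul_cexp]
  ext ω
  simpa [Pi.single_apply] using key (Pi.single ω 1)

lemma cexp_idem : cexp r (cexp r f) = cexp r f := cexp_cexp_of_le r r f le_rfl

lemma sqn_sub_cexp : sqn (f - cexp r f) = sqn f - sqn (cexp r f) := by
  have h : ∑ ω, f ω * cexp r f ω = ∑ ω, cexp r f ω * cexp r f ω := by
    rw [← sum_mul_cexp, cexp_idem]
  have e : sqn (f - cexp r f) =
      sqn f - 2 * ∑ ω, f ω * cexp r f ω + ∑ ω, cexp r f ω * cexp r f ω := by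
    simp only [sqn, Finset.mul_sum, ← Finset.sum_sub_distrib, ← Finset.sum_add_distrib]
    exact Finset.sum_congr rfl fun ω _ => by simp only [Pi.sub_apply]; ring
  have e' : sqn (cexp r f) = ∑ ω, cexp r f ω * cexp r f ω :=
    Finset.sum_congr rfl fun ω _ => by ring
  rw [e, h, e']
  ring

lemma sqn_sub_cexp_le : sqn (f - cexp r f) ≤ sqn f := by
  rw [sqn_sub_cexp]
  linarith [sqn_nonneg (cexp r f)]

lemma sqn_sub_cexp_eq : sqn (f - cexp r f) = ∑ ω, f ω * (f ω - cexp r f ω) := by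
  have h : ∑ ω, f ω * cexp r f ω = ∑ ω, cexp r f ω * cexp r f ω := by
    rw [← sum_mul_cexp, cexp_idem]
  have e' : sqn (cexp r f) = ∑ ω, cexp r f ω * cexp r f ω :=
    Finset.sum_congr rfl fun ω _ => by ring
  rw [sqn_sub_cexp, e', ← h, sqn, ← Finset.sum_sub_distrib]
  exact Finset.sum_congr rfl fun ω _ => by ring

/-- Averaging over smaller classes changes a function less. -/
lemma sqn_sub_cexp_mono (h : r ≤ t) : sqn (f - cexp r f) ≤ sqn (f - cexp t f) := by
  have : f - cexp r f = (f - cexp t f) - cexp r (f - cexp t f) := by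
    rw [cexp_sub, cexp_cexp_of_le r t f h]
    abel
  rw [this]
  exact sqn_sub_cexp_le _ _

lemma sqn_sum_le (n : ℕ) (F : ℕ → Ω → ℝ) :
    sqn (∑ j ∈ Finset.range n, F j) ≤ n * ∑ j ∈ Finset.range n, sqn (F j) := by
  simp only [sqn]
  rw [Finset.sum_comm, Finset.mul_sum]
  refine Finset.sum_le_sum fun ω _ => ?_
  simpa using sq_sum_le_card_mul_sum_sq (s := Finset.range n) (f := fun j => F j ω)

/-- If a function is changed much by one of `k` averaging operators, then its norm drops when
they are applied one after the other. -/
lemma sqn_sub_cexp_le_of_iterate (s : ℕ → Setoid Ω) (F : ℕ → Ω → ℝ)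
    (hF : ∀ i, F (i + 1) = cexp (s i) (F i)) {i k : ℕ} (hi : i < k) :
    sqn (F 0 - cexp (s i) (F 0)) ≤ k * (sqn (F 0) - sqn (F k)) := by
  have hsum : ∀ n, F 0 - F n = ∑ j ∈ Finset.range n, (F j - F (j + 1)) := fun n => by
    rw [Finset.sum_range_sub' F n]
  have hdrop : ∀ j, sqn (F j - F (j + 1)) = sqn (F j) - sqn (F (j + 1)) := fun j => by
    rw [hF, sqn_sub_cexp]
  -- `F (i + 1)` is in the range of the `i`-th projection, so the distance from `F 0` to that range
  -- is at most the distance from `F 0` to `F (i + 1)`. The latter is controlled by the increments,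
  -- whose squared norms telescope by Pythagoras.
  have e : F 0 - cexp (s i) (F 0) = (F 0 - F (i + 1)) - cexp (s i) (F 0 - F (i + 1)) := by
    rw [cexp_sub, hF i, cexp_idem]
    abel
  have hmono : ∑ j ∈ Finset.range (i + 1), sqn (F j - F (j + 1)) ≤
      ∑ j ∈ Finset.range k, sqn (F j - F (j + 1)) :=
    Finset.sum_le_sum_of_subset_of_nonneg
      (fun j hj => Finset.mem_range.2 (by have := Finset.mem_range.1 hj; omega))
      fun _ _ _ => sqn_nonneg _
  have htel : ∑ j ∈ Finset.range k, sqn (F j - F (j + 1)) = sqn (F 0) - sqn (F k) := by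
    simp only [hdrop]
    exact Finset.sum_range_sub' (fun j => sqn (F j)) k
  have h0 : (0 : ℝ) ≤ ∑ j ∈ Finset.range k, sqn (F j - F (j + 1)) :=
    Finset.sum_nonneg fun _ _ => sqn_nonneg _
  have hik : ((i + 1 : ℕ) : ℝ) ≤ k := by exact_mod_cast hi
  calc sqn (F 0 - cexp (s i) (F 0)) ≤ sqn (F 0 - F (i + 1)) := by
        rw [e]; exact sqn_sub_cexp_le _ _
    _ ≤ (i + 1 : ℕ) * ∑ j ∈ Finset.range (i + 1), sqn (F j - F (j + 1)) := by
        rw [hsum]; exact sqn_sum_le _ _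
    _ ≤ k * ∑ j ∈ Finset.range k, sqn (F j - F (j + 1)) :=
        mul_le_mul hik hmono (Finset.sum_nonneg fun _ _ => sqn_nonneg _) (Nat.cast_nonneg k)
    _ = _ := by rw [htel]

end Averaging

/-! ## Spectral gaps from contraction of a Lipschitz seminorm -/

section Gap

variable {Ω : Type} [Fintype Ω]

/-- A symmetric operator on `Ω → ℝ` whose eigenvalues are at most `b ≥ 0` has quadratic form
at most `b`. -/
lemma quadratic_form_le_of_eigenvalue_le (T : (Ω → ℝ) →ₗ[ℝ] (Ω → ℝ))
    (hT : ∀ f g : Ω → ℝ, ∑ ω, g ω * T f ω = ∑ ω, T g ω * f ω) {b : ℝ}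
    (hb : ∀ (μ : ℝ) (f : Ω → ℝ), f ≠ 0 → T f = μ • f → μ ≤ b) (f : Ω → ℝ) :
    ∑ ω, f ω * T f ω ≤ b * sqn f := by
  by_cases hf : f = 0
  · subst hf; simp [sqn]
  let L : EuclideanSpace ℝ Ω ≃ₗ[ℝ] (Ω → ℝ) := WithLp.linearEquiv 2 ℝ (Ω → ℝ)
  let T' : EuclideanSpace ℝ Ω →ₗ[ℝ] EuclideanSpace ℝ Ω := L.symm.toLinearMap ∘ₗ T ∘ₗ L.toLinearMap
  have hin : ∀ x y : EuclideanSpace ℝ Ω, inner ℝ x y = ∑ ω, L x ω * L y ω := fun x y => by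
    simp only [PiLp.inner_apply, L]
    exact Finset.sum_congr rfl fun ω _ => by simp [mul_comm]
  have hLT : ∀ x, L (T' x) = T (L x) := fun x => by simp [T']
  have hsym : T'.IsSymmetric := fun x y => by
    rw [hin, hin, hLT, hLT]
    exact (hT _ _).symm
  have : Nontrivial (EuclideanSpace ℝ Ω) :=
    ⟨⟨L.symm f, 0, fun h => hf (by simpa using h)⟩⟩
  -- In finite dimension the supremum of the Rayleigh quotient is itself an eigenvalue, so the bound
  -- on eigenvalues bounds every quotient.
  have hev := hsym.hasEigenvalue_iSup_of_finiteDimensional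
  set S : ℝ := ⨆ x : {x : EuclideanSpace ℝ Ω // x ≠ 0},
    RCLike.re (inner ℝ (T' x) (x : EuclideanSpace ℝ Ω)) / ‖(x : EuclideanSpace ℝ Ω)‖ ^ 2 with hS
  obtain ⟨x, hx⟩ := hev.exists_hasEigenvector
  have hSb : S ≤ b := by
    refine hb S (L x) (fun h => hx.2 (by simpa using h)) ?_
    rw [← hLT, hx.apply_eq_smul]
    simp
  have hbdd : BddAbove (Set.range fun x : {x : EuclideanSpace ℝ Ω // x ≠ 0} =>
      RCLike.re (inner ℝ (T' x) (x : EuclideanSpace ℝ Ω)) / ‖(x : EuclideanSpace ℝ Ω)‖ ^ 2) := by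
    refine ⟨‖T'.toContinuousLinearMap‖, ?_⟩
    rintro _ ⟨⟨y, hy⟩, rfl⟩
    have hy' : 0 < ‖y‖ := norm_pos_iff.2 hy
    simp only [RCLike.re_to_real]
    rw [div_le_iff₀ (by positivity)]
    calc inner ℝ (T' y) y ≤ ‖T' y‖ * ‖y‖ := real_inner_le_norm _ _
      _ ≤ (‖T'.toContinuousLinearMap‖ * ‖y‖) * ‖y‖ := by
          gcongr
          exact T'.toContinuousLinearMap.le_opNorm y
      _ = _ := by ring
  have hne : L.symm f ≠ 0 := fun h => hf (by simpa using h)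
  have hle := le_ciSup hbdd ⟨L.symm f, hne⟩
  have hpos : 0 < ‖L.symm f‖ ^ 2 := by have := norm_pos_iff.2 hne; positivity
  have hnorm : ‖L.symm f‖ ^ 2 = sqn f := by
    rw [← real_inner_self_eq_norm_sq, hin]
    simp only [LinearEquiv.apply_symm_apply, sqn]
    exact Finset.sum_congr rfl fun ω _ => by ring
  have h1 := hle.trans hSb
  simp only [RCLike.re_to_real] at h1
  rw [div_le_iff₀ hpos, hnorm, hin, hLT] at h1
  simp only [LinearEquiv.apply_symm_apply] at h1
  calc _ = ∑ ω, T f ω * f ω := Finset.sum_congr rfl fun ω _ => by ring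
    _ ≤ _ := h1

/-- If the sum of averaging operators contracts the Lipschitz seminorm defined by the weighted
edges `E`, then the associated Dirichlet form has a spectral gap. -/
lemma gap_of_contraction {V ι : Type*} (E : V → Ω → Ω → Prop) (s : Finset V) (w : V → ℝ)
    (hw : ∀ v ∈ s, 0 < w v) (J : Finset ι) (r : ι → Setoid Ω) (t : Setoid Ω)
    (hrt : ∀ j ∈ J, r j ≤ t) (γ : ℝ)
    (hconst : ∀ f : Ω → ℝ, (∀ v ∈ s, ∀ ω ω', E v ω ω' → f ω' = f ω) → cexp t f = f)
    (hcon : ∀ (f : Ω → ℝ) (M : ℝ), 0 ≤ M →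
      (∀ v ∈ s, ∀ ω ω', E v ω ω' → |f ω' - f ω| ≤ M * w v) →
      ∀ v ∈ s, ∀ ω ω', E v ω ω' →
        |∑ j ∈ J, (cexp (r j) f ω' - cexp (r j) f ω)| ≤ (J.card - γ) * (M * w v))
    (f : Ω → ℝ) :
    γ * sqn (f - cexp t f) ≤ ∑ j ∈ J, sqn (f - cexp (r j) f) := by
  -- At an edge where the weighted slope is maximal, `M * w v` equals the actual increment, so the
  -- contraction hypothesis compares the operator with `f` on that edge. The slope is nonzero, as
  -- otherwise `hconst` would force `f = 0`.
  have hmax : ∀ f : Ω → ℝ, f ≠ 0 → cexp t f = 0 → ∃ v ∈ s, ∃ ω ω', E v ω ω' ∧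
      0 < |f ω' - f ω| ∧ |∑ j ∈ J, (cexp (r j) f ω' - cexp (r j) f ω)| ≤
        (J.card - γ) * |f ω' - f ω| := by
    intro f hf htf
    let X : Finset (V × Ω × Ω) := (s ×ˢ Finset.univ).filter fun e => E e.1 e.2.1 e.2.2
    have hX : ∀ e, e ∈ X ↔ e.1 ∈ s ∧ E e.1 e.2.1 e.2.2 := fun e => by simp [X]
    obtain ⟨e₀, he₀, hne⟩ : ∃ e ∈ X, f e.2.2 ≠ f e.2.1 := by
      by_contra! hcontra
      exact hf ((hconst f fun v hv ω ω' h => hcontra (v, ω, ω') ((hX _).2 ⟨hv, h⟩)).symm.trans htf)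
    obtain ⟨e, he, hemax⟩ := X.exists_max_image (fun e => |f e.2.2 - f e.2.1| / w e.1) ⟨e₀, he₀⟩
    obtain ⟨hes, heE⟩ := (hX e).1 he
    have hwe := hw _ hes
    have hpos : 0 < |f e.2.2 - f e.2.1| / w e.1 :=
      (div_pos (abs_pos.2 (sub_ne_zero.2 hne)) (hw _ ((hX e₀).1 he₀).1)).trans_le (hemax e₀ he₀)
    refine ⟨e.1, hes, e.2.1, e.2.2, heE, (div_pos_iff_of_pos_right hwe).1 hpos, ?_⟩
    have := hcon f _ hpos.le (fun v hv ω ω' h => by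
      have := hemax (v, ω, ω') ((hX _).2 ⟨hv, h⟩)
      rwa [div_le_iff₀ (hw v hv)] at this) _ hes _ _ heE
    rwa [div_mul_cancel₀ _ hwe.ne'] at this
  set g := f - cexp t f with hg
  have htg : cexp t g = 0 := by rw [hg, cexp_sub, cexp_idem, sub_self]
  have hfg : ∀ j ∈ J, f - cexp (r j) f = g - cexp (r j) g := fun j hj => by
    rw [hg, cexp_sub, cexp_cexp_of_le _ _ _ (hrt j hj)]
    abel
  rw [Finset.sum_congr rfl fun j hj => by rw [hfg j hj]]
  by_cases hg0 : g = 0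
  · rw [hg0]
    have h0 : sqn (0 : Ω → ℝ) = 0 := by simp [sqn]
    rw [h0, mul_zero]
    exact Finset.sum_nonneg fun j _ => sqn_nonneg _
  have hb : 0 ≤ J.card - γ := by
    obtain ⟨v, -, ω, ω', -, hpos, hle⟩ := hmax g hg0 htg
    exact nonneg_of_mul_nonneg_left ((abs_nonneg _).trans hle) hpos
  -- Subtracting `J.card` times the coarse projection kills the functions that are constant on
  -- classes of `t`. An eigenvector of `T` then has eigenvalue `0` or satisfies `cexp t f = 0`, and
  -- in the second case the extremal edge applies.
  obtain ⟨T, hTdef⟩ : ∃ T : (Ω → ℝ) →ₗ[ℝ] (Ω → ℝ),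
      ∀ f, T f = ∑ j ∈ J, cexp (r j) f - (J.card : ℝ) • cexp t f :=
    ⟨∑ j ∈ J, cexpₗ (r j) - (J.card : ℝ) • cexpₗ t, fun f => by
      simp [LinearMap.sum_apply, cexpₗ]⟩
  have hTapp : ∀ f ω, T f ω = ∑ j ∈ J, cexp (r j) f ω - J.card * cexp t f ω := fun f ω => by
    simp [hTdef]
  have hsym : ∀ f g : Ω → ℝ, ∑ ω, g ω * T f ω = ∑ ω, T g ω * f ω := fun f g => by
    simp only [hTapp, mul_sub, sub_mul, Finset.sum_sub_distrib, Finset.mul_sum, Finset.sum_mul]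
    congr 1
    · rw [Finset.sum_comm, Finset.sum_comm (s := Finset.univ)]
      exact Finset.sum_congr rfl fun j _ => sum_mul_cexp _ _ _
    · simp only [mul_left_comm _ (J.card : ℝ), mul_assoc, ← Finset.mul_sum]
      rw [sum_mul_cexp]
  have hq := quadratic_form_le_of_eigenvalue_le T hsym (b := J.card - γ) (fun μ f hf hTf => by
    have h0 : μ • cexp t f = 0 := by
      rw [← cexp_smul, ← hTf, hTdef, cexp_sub, cexp_sum, cexp_smul, cexp_idem,
        Finset.sum_congr rfl fun j hj => cexp_cexp_of_ge (r j) t f (hrt j hj), Finset.sum_const,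
        ← Nat.cast_smul_eq_nsmul ℝ, sub_self]
    rcases smul_eq_zero.1 h0 with h0 | h0
    · rw [h0]; exact hb
    · obtain ⟨v, -, ω, ω', -, hpos, hle⟩ := hmax f hf h0
      have hTω : ∀ ω, ∑ j ∈ J, cexp (r j) f ω = μ * f ω := fun ω => by
        have := congrFun hTf ω
        rwa [hTapp, h0, Pi.zero_apply, mul_zero, sub_zero] at this
      rw [Finset.sum_sub_distrib, hTω, hTω, ← mul_sub, abs_mul] at hle
      exact (le_abs_self μ).trans (le_of_mul_le_mul_right hle hpos)) g
  have hsum : ∑ j ∈ J, sqn (g - cexp (r j) g) = J.card * sqn g - ∑ ω, g ω * T g ω := by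
    simp only [hTapp, htg, Pi.zero_apply, mul_zero, sub_zero, Finset.mul_sum]
    rw [Finset.sum_comm, ← nsmul_eq_mul, ← Finset.sum_const, ← Finset.sum_sub_distrib]
    refine Finset.sum_congr rfl fun j _ => ?_
    rw [sqn_sub_cexp_eq, sqn, ← Finset.sum_sub_distrib]
    exact Finset.sum_congr rfl fun ω _ => by ring
  rw [hsum]
  linarith

end Gap

/-! ## Comparing averages -/

section Compare

variable {Ω : Type}

/-- The hypotheses say that `rel` is the graph of a bijection from `S` to `T`; in the applications
`rel` is a change of height at one site. -/
lemma sum_transport {S T : Finset Ω} (rel : Ω → Ω → Prop) (h₁ : ∀ a ∈ S, ∃ b ∈ T, rel a b)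
    (h₂ : ∀ b ∈ T, ∃ a ∈ S, rel a b)
    (u₁ : ∀ a ∈ S, ∀ b ∈ T, ∀ b' ∈ T, rel a b → rel a b' → b = b')
    (u₂ : ∀ a ∈ S, ∀ a' ∈ S, ∀ b ∈ T, rel a b → rel a' b → a = a') {f : Ω → ℝ} {ε : ℝ}
    (hf : ∀ a ∈ S, ∀ b ∈ T, rel a b → |f b - f a| ≤ ε) :
    T.card = S.card ∧ |∑ b ∈ T, f b - ∑ a ∈ S, f a| ≤ S.card * ε := by
  choose! φ hφ using h₁
  have hinj : Set.InjOn φ S := fun a ha a' ha' h =>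
    u₂ a ha a' ha' (φ a) (hφ a ha).1 (hφ a ha).2 (h ▸ (hφ a' ha').2)
  have himg : S.image φ = T := by
    ext b
    rw [Finset.mem_image]
    constructor
    · rintro ⟨a, ha, rfl⟩
      exact (hφ a ha).1
    · intro hb
      obtain ⟨a, ha, hab⟩ := h₂ b hb
      exact ⟨a, ha, u₁ a ha _ (hφ a ha).1 b hb (hφ a ha).2 hab⟩
  refine ⟨by rw [← himg, Finset.card_image_of_injOn hinj], ?_⟩
  rw [← himg, Finset.sum_image hinj, ← Finset.sum_sub_distrib, ← nsmul_eq_mul, ← Finset.sum_const]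
  exact (Finset.abs_sum_le_sum_abs _ _).trans
    (Finset.sum_le_sum fun a ha => hf a ha _ (hφ a ha).1 (hφ a ha).2)

lemma abs_ave_sub_ave_le_of_transport {S T : Finset Ω} (hS : S.Nonempty) {f : Ω → ℝ} {ε : ℝ}
    (h : T.card = S.card ∧ |∑ b ∈ T, f b - ∑ a ∈ S, f a| ≤ S.card * ε) :
    |ave T f - ave S f| ≤ ε := by
  have hpos : (0 : ℝ) < S.card := by exact_mod_cast hS.card_pos
  rw [ave, ave, h.1, ← sub_div, abs_div, abs_of_pos hpos, div_le_iff₀ hpos, mul_comm ε]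
  exact h.2

/-- The inductive step for nested conditioning, in which the bound `δ / 2` reproduces itself. With
`c` the common size of the two differences and `n = S₁.card`, the difference of averages is at most
`(c * δ + (n - c) * (δ / 2)) / (c + n) = δ / 2`. -/
lemma abs_ave_sub_ave_le_of_nested {S₀ S₁ S₂ : Finset Ω} (h₁₀ : S₁ ⊆ S₀) (h₂₁ : S₂ ⊆ S₁)
    (hne : S₁.Nonempty) {f : Ω → ℝ} {δ : ℝ}
    (h : (S₁ \ S₂).card = (S₀ \ S₁).card ∧
      |∑ b ∈ S₁ \ S₂, f b - ∑ a ∈ S₀ \ S₁, f a| ≤ (S₀ \ S₁).card * δ)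
    (hδ : S₂.Nonempty → |ave S₁ f - ave S₂ f| ≤ δ / 2) :
    |ave S₀ f - ave S₁ f| ≤ δ / 2 := by
  have hn : (0 : ℝ) < S₁.card := by exact_mod_cast hne.card_pos
  have e0 : ∑ a ∈ S₀, f a = ∑ a ∈ S₀ \ S₁, f a + ∑ a ∈ S₁, f a := (Finset.sum_sdiff h₁₀).symm
  have e1 : ∑ a ∈ S₁, f a = ∑ a ∈ S₁ \ S₂, f a + ∑ a ∈ S₂, f a := (Finset.sum_sdiff h₂₁).symm
  have c0 : (S₀.card : ℝ) = (S₀ \ S₁).card + S₁.card := by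
    exact_mod_cast (Finset.card_sdiff_add_card_eq_card h₁₀).symm
  have c1 : (S₁.card : ℝ) = (S₀ \ S₁).card + S₂.card := by
    rw [← h.1]
    exact_mod_cast (Finset.card_sdiff_add_card_eq_card h₂₁).symm
  have h2 := h.2
  set p := ∑ a ∈ S₀ \ S₁, f a
  set q := ∑ a ∈ S₁ \ S₂, f a
  set b := ∑ a ∈ S₂, f a with hb
  set c : ℝ := ((S₀ \ S₁).card : ℝ)
  set n : ℝ := (S₁.card : ℝ) with hn'
  set m : ℝ := (S₂.card : ℝ) with hm'
  have hc : 0 ≤ c := Nat.cast_nonneg _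
  -- The bound on `ave S₁ f - ave S₂ f` with denominators cleared, which also holds, trivially, when
  -- `S₂` is empty.
  have key : |m * q - c * b| ≤ n * m * (δ / 2) := by
    rcases S₂.eq_empty_or_nonempty with hS | hS
    · have hm0 : m = 0 := by simp [hm', hS]
      have hb0 : b = 0 := by simp [hb, hS]
      simp [hm0, hb0]
    · have hm : (0 : ℝ) < m := by simpa [hm'] using hS.card_pos
      have := hδ hS
      rw [ave, ave, e1, ← hn', ← hm', div_sub_div _ _ hn.ne' hm.ne', abs_div,
        abs_of_pos (mul_pos hn hm), div_le_iff₀ (mul_pos hn hm)] at this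
      have e : m * q - c * b = (q + b) * m - n * b := by rw [c1]; ring
      rw [e]
      linarith
  rw [ave, ave, e0, c0, ← hn', div_sub_div _ _ (by positivity) hn.ne', abs_div,
    abs_of_pos (by positivity : (0 : ℝ) < (c + n) * n), div_le_iff₀ (by positivity)]
  have e : (p + ∑ a ∈ S₁, f a) * n - (c + n) * ∑ a ∈ S₁, f a = -(n * (q - p)) + (m * q - c * b) := by
    have : n * q - m * q = c * q := by rw [c1]; ring
    rw [e1]
    linear_combination this
  rw [e]
  have hnm : n * m * (δ / 2) = n * (n - c) * (δ / 2) := by rw [c1]; ring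
  calc |-(n * (q - p)) + (m * q - c * b)| ≤ |-(n * (q - p))| + |m * q - c * b| := abs_add_le _ _
    _ ≤ n * (c * δ) + n * m * (δ / 2) := by
        rw [abs_neg, abs_mul, abs_of_pos hn]
        gcongr
    _ = _ := by rw [hnm]; ring

end Compare

/-! ## Height functions as functions on `ℤ²` -/

section Heights

variable {R : Finset (ℤ × ℤ)} {h : boundary R → ℤ}

/-- The interior of `R`. -/
def inner (R : Finset (ℤ × ℤ)) : Finset (ℤ × ℤ) := R \ boundary R

/-- The height at `z`, extended by zero outside `R`. -/
def ht (H : HeightFun R h) (z : ℤ × ℤ) : ℤ := if hz : z ∈ R then H.1 ⟨z, hz⟩ else 0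

lemma ht_of_mem (H : HeightFun R h) {z : ℤ × ℤ} (hz : z ∈ R) : ht H z = H.1 ⟨z, hz⟩ := dif_pos hz

lemma ht_injective : Function.Injective (ht : HeightFun R h → ℤ × ℤ → ℤ) := by
  intro H H' e
  refine Subtype.ext (funext fun z => ?_)
  have := congrFun e z
  rwa [ht_of_mem H z.2, ht_of_mem H' z.2] at this

lemma ht_eq_of_notMem_inner (H H' : HeightFun R h) {z : ℤ × ℤ} (hz : z ∉ inner R) :
    ht H z = ht H' z := by
  by_cases hR : z ∈ R
  · have hb : z ∈ boundary R := by
      by_contra hb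
      exact hz (Finset.mem_sdiff.2 ⟨hR, hb⟩)
    rw [ht_of_mem H hR, ht_of_mem H' hR, H.2.2 ⟨z, hb⟩, H'.2.2 ⟨z, hb⟩]
  · rw [ht, ht, dif_neg hR, dif_neg hR]

lemma inner_subset : inner R ⊆ R := Finset.sdiff_subset

lemma mem_of_adj_inner {z w : ℤ × ℤ} (hz : z ∈ inner R) (hzw : triLattice.Adj z w) : w ∈ R := by
  by_contra hw
  obtain ⟨hzR, hzb⟩ := Finset.mem_sdiff.1 hz
  exact hzb (Finset.mem_filter.2 ⟨hzR, w, hw, hzw⟩)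

lemma ht_step (H : HeightFun R h) {u v : ℤ × ℤ} (hu : u ∈ R) (hv : v ∈ R)
    (huv : v = u + (1, 0) ∨ v = u + (0, -1) ∨ v = u + (1, 1)) :
    ht H u ≤ ht H v ∧ ht H v ≤ ht H u + 1 := by
  rw [ht_of_mem H hu, ht_of_mem H hv]
  have := H.2.1 ⟨u, hu⟩ ⟨v, hv⟩ huv
  omega

/-- The height `t` at `(x, y)` is compatible with the heights of `H` at the neighbours. -/
structure Fits (H : HeightFun R h) (x y t : ℤ) : Prop where
  right : t ≤ ht H (x + 1, y) ∧ ht H (x + 1, y) ≤ t + 1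
  down : t ≤ ht H (x, y - 1) ∧ ht H (x, y - 1) ≤ t + 1
  upRight : t ≤ ht H (x + 1, y + 1) ∧ ht H (x + 1, y + 1) ≤ t + 1
  left : t - 1 ≤ ht H (x - 1, y) ∧ ht H (x - 1, y) ≤ t
  up : t - 1 ≤ ht H (x, y + 1) ∧ ht H (x, y + 1) ≤ t
  downLeft : t - 1 ≤ ht H (x - 1, y - 1) ∧ ht H (x - 1, y - 1) ≤ t

lemma neighbours_mem {x y : ℤ} (hz : (x, y) ∈ inner R) :
    (x + 1, y) ∈ R ∧ (x, y - 1) ∈ R ∧ (x + 1, y + 1) ∈ R ∧ (x - 1, y) ∈ R ∧ (x, y + 1) ∈ R ∧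
      (x - 1, y - 1) ∈ R := by
  refine ⟨?_, ?_, ?_, ?_, ?_, ?_⟩ <;> refine mem_of_adj_inner hz ?_ <;>
    simp [triLattice]

lemma fits_self (H : HeightFun R h) {x y : ℤ} (hz : (x, y) ∈ inner R) :
    Fits H x y (ht H (x, y)) := by
  obtain ⟨h1, h2, h3, h4, h5, h6⟩ := neighbours_mem hz
  have h0 := inner_subset hz
  have s4 := ht_step H h4 h0 (by simp)
  have s5 := ht_step H h5 h0 (by simp)
  have s6 := ht_step H h6 h0 (by simp)
  refine ⟨ht_step H h0 h1 (by simp), ht_step H h0 h2 (by simp [sub_eq_add_neg]),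
    ht_step H h0 h3 (by simp), ?_, ?_, ?_⟩ <;> omega

/-- The inequalities between the heights at consecutive neighbours of an interior vertex. -/
lemma ht_hexagon (H : HeightFun R h) {x y : ℤ} (hz : (x, y) ∈ inner R) :
    (ht H (x, y - 1) ≤ ht H (x + 1, y) ∧ ht H (x + 1, y) ≤ ht H (x, y - 1) + 1) ∧
    (ht H (x + 1, y + 1) ≤ ht H (x + 1, y) ∧ ht H (x + 1, y) ≤ ht H (x + 1, y + 1) + 1) ∧
    (ht H (x, y + 1) ≤ ht H (x + 1, y + 1) ∧ ht H (x + 1, y + 1) ≤ ht H (x, y + 1) + 1) ∧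
    (ht H (x - 1, y) ≤ ht H (x, y + 1) ∧ ht H (x, y + 1) ≤ ht H (x - 1, y) + 1) ∧
    (ht H (x - 1, y) ≤ ht H (x - 1, y - 1) ∧ ht H (x - 1, y - 1) ≤ ht H (x - 1, y) + 1) ∧
    (ht H (x - 1, y - 1) ≤ ht H (x, y - 1) ∧ ht H (x, y - 1) ≤ ht H (x - 1, y - 1) + 1) := by
  obtain ⟨h1, h2, h3, h4, h5, h6⟩ := neighbours_mem hz
  exact ⟨ht_step H h2 h1 (by simp), ht_step H h3 h1 (by simp), ht_step H h5 h3 (by simp),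
    ht_step H h4 h5 (by simp), ht_step H h4 h6 (by simp [sub_eq_add_neg]),
    ht_step H h6 h2 (by simp)⟩

/-- Two height functions are equivalent if they agree outside `U`. -/
def agree (R : Finset (ℤ × ℤ)) (h : boundary R → ℤ) (U : Finset (ℤ × ℤ)) :
    Setoid (HeightFun R h) where
  r H H' := ∀ z, z ∉ U → ht H z = ht H' z
  iseqv := ⟨fun _ _ _ => rfl, fun e z hz => (e z hz).symm, fun e e' z hz => (e z hz).trans (e' z hz)⟩

lemma agree_mono {U U' : Finset (ℤ × ℤ)} (hU : U ⊆ U') : agree R h U ≤ agree R h U' :=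
  fun _ _ e z hz => e z fun hz' => hz (hU hz')

lemma eq_of_agree_of_ht {z : ℤ × ℤ} {H H' : HeightFun R h} (e : (agree R h {z}).r H H')
    (hz : ht H z = ht H' z) : H = H' := by
  refine ht_injective (funext fun w => ?_)
  by_cases hw : w = z
  · rw [hw, hz]
  · exact e w (by simpa using hw)

lemma exists_update (H : HeightFun R h) {x y t : ℤ} (hz : (x, y) ∈ inner R) (ht' : Fits H x y t) :
    ∃ H' : HeightFun R h, (agree R h {(x, y)}).r H H' ∧ ht H' (x, y) = t := by
  have hzR := inner_subset hz
  obtain ⟨H', hH'⟩ : ∃ H' : HeightFun R h, ∀ u : R,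
      H'.1 u = if (u : ℤ × ℤ) = (x, y) then t else H.1 u := by
    refine ⟨⟨fun u => if (u : ℤ × ℤ) = (x, y) then t else H.1 u, ?_, ?_⟩, fun _ => rfl⟩
    · have key : ∀ u : R, H.1 u = ht H u := fun u => (ht_of_mem H u.2).symm
      intro u v huv
      by_cases hu : (u : ℤ × ℤ) = (x, y) <;> by_cases hv : (v : ℤ × ℤ) = (x, y)
      · exfalso
        rw [hu, hv] at huv
        simp at huv
      · simp only [hu, hv, if_true, if_false, key]
        rw [hu] at huv
        obtain ⟨a1, a2, a3, a4, a5, a6⟩ := ht'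
        rcases huv with e | e | e <;> simp only [Prod.mk_add_mk, add_zero, ← sub_eq_add_neg] at e <;>
          rw [e] <;> omega
      · simp only [hu, hv, if_true, if_false, key]
        rw [hv] at huv
        obtain ⟨a1, a2, a3, a4, a5, a6⟩ := ht'
        have e : (u : ℤ × ℤ) = (x - 1, y) ∨ (u : ℤ × ℤ) = (x, y + 1) ∨
            (u : ℤ × ℤ) = (x - 1, y - 1) := by
          simp only [Prod.ext_iff, Prod.fst_add, Prod.snd_add] at huv ⊢
          omega
        rcases e with e | e | e <;> rw [e] <;> omega
      · simp only [hu, hv, if_false]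
        exact H.2.1 u v huv
    · intro v
      have hv : (v : ℤ × ℤ) ≠ (x, y) := fun e => (Finset.mem_sdiff.1 hz).2 (e ▸ v.2)
      simp only [hv, if_false]
      exact H.2.2 v
  refine ⟨H', fun w hw => ?_, ?_⟩
  · by_cases hwR : w ∈ R
    · rw [ht_of_mem _ hwR, ht_of_mem _ hwR, hH', if_neg (by simpa using hw)]
    · simp only [ht, dif_neg hwR]
  · rw [ht_of_mem _ hzR, hH', if_pos rfl]

/-- Height functions that agree outside a set of interior vertices are joined by single-site
changes in that set. -/
lemma eq_of_forall_agree_singleton {α : Type*} {U : Finset (ℤ × ℤ)} (hU : U ⊆ inner R)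
    {f : HeightFun R h → α} (hf : ∀ z ∈ U, ∀ F F', (agree R h {z}).r F F' → f F' = f F)
    (H H' : HeightFun R h) (e : (agree R h U).r H H') : f H' = f H := by
  have main : ∀ n : ℕ, ∀ H H' : HeightFun R h, (agree R h U).r H H' →
      ∑ z ∈ U, (ht H z - ht H' z).natAbs ≤ n → f H' = f H := by
    intro n
    induction n with
    | zero =>
      intro H H' e hs
      have : H' = H := by
        refine ht_injective (funext fun z => ?_)
        by_cases hz : z ∈ U
        · have := Finset.sum_eq_zero_iff.1 (Nat.le_zero.1 hs) z hz
          omega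
        · exact (e z hz).symm
      rw [this]
    | succ n ih =>
      have up : ∀ H H' : HeightFun R h, (agree R h U).r H H' →
          ∑ z ∈ U, (ht H z - ht H' z).natAbs ≤ n + 1 → (∃ z, ht H z < ht H' z) → f H' = f H := by
        intro H H' e hs hex
        have hUz : ∀ z, ht H z < ht H' z → z ∈ U := fun z hz => by
          by_contra hzU
          exact hz.ne (e z hzU)
        let X := U.filter fun z => ht H z < ht H' z
        have hX : ∀ z, z ∈ X ↔ ht H z < ht H' z := fun z => by
          simp only [X, Finset.mem_filter]
          exact ⟨fun a => a.2, fun a => ⟨hUz z a, a⟩⟩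
        -- Among the vertices where `H < H'`, take one of least height in `H`, and among those one
        -- maximizing `2 * x - y`, which increases along each of the three directions in which
        -- heights are nondecreasing. There `H` can be raised by one: an obstructing neighbour would
        -- also satisfy `H < H'`, and be lower, or equally high with larger `2 * x - y`.
        obtain ⟨z₀, hz₀⟩ := hex
        obtain ⟨z₁, hz₁, hmin⟩ := X.exists_min_image (fun z => ht H z) ⟨z₀, (hX _).2 hz₀⟩
        obtain ⟨⟨x, y⟩, hxy, hmax⟩ := (X.filter fun z => ht H z = ht H z₁).exists_max_image
          (fun z => 2 * z.1 - z.2) ⟨z₁, Finset.mem_filter.2 ⟨hz₁, rfl⟩⟩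
        obtain ⟨hxyX, hxy1⟩ := Finset.mem_filter.1 hxy
        have hlt := (hX _).1 hxyX
        have hxyU := hUz _ hlt
        have hin := hU hxyU
        have hmin' : ∀ z, ht H z < ht H' z → ht H (x, y) ≤ ht H z := fun z hz => by
          rw [hxy1]; exact hmin z ((hX z).2 hz)
        have hmax' : ∀ z, ht H z < ht H' z → ht H z = ht H (x, y) → 2 * z.1 - z.2 ≤ 2 * x - y :=
          fun z hz hz' => hmax z (Finset.mem_filter.2 ⟨(hX z).2 hz, by rw [hz', hxy1]⟩)
        have hfit : Fits H x y (ht H (x, y) + 1) := by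
          obtain ⟨a1, a2, a3, a4, a5, a6⟩ := fits_self H hin
          obtain ⟨b1, b2, b3, b4, b5, b6⟩ := fits_self H' hin
          have m1 := hmax' (x + 1, y)
          have m2 := hmax' (x, y - 1)
          have m3 := hmax' (x + 1, y + 1)
          have m4 := hmin' (x - 1, y)
          have m5 := hmin' (x, y + 1)
          have m6 := hmin' (x - 1, y - 1)
          simp only at m1 m2 m3
          constructor <;> omega
        obtain ⟨F, hF, hFt⟩ := exists_update H hin hfit
        have hFU : (agree R h U).r F H' :=
          (agree R h U).iseqv.trans ((agree R h U).iseqv.symm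
            (agree_mono (Finset.singleton_subset_iff.2 hxyU) hF)) e
        rw [ih F H' hFU ?_, hf _ hxyU H F hF]
        rw [← Finset.add_sum_erase _ _ hxyU] at hs ⊢
        have : ∑ z ∈ U.erase (x, y), (ht F z - ht H' z).natAbs =
            ∑ z ∈ U.erase (x, y), (ht H z - ht H' z).natAbs :=
          Finset.sum_congr rfl fun z hz => by
            rw [hF z (by simpa using (Finset.mem_erase.1 hz).1)]
        rw [this, hFt]
        omega
      intro H H' e hs
      by_cases h1 : ∃ z, ht H z < ht H' z
      · exact up H H' e hs h1
      by_cases h2 : ∃ z, ht H' z < ht H z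
      · refine (up H' H ((agree R h U).iseqv.symm e) ?_ h2).symm
        refine le_trans (le_of_eq ?_) hs
        exact Finset.sum_congr rfl fun z _ => by omega
      · push Not at h1 h2
        rw [ht_injective (funext fun z => le_antisymm (h1 z) (h2 z))]
  exact main _ H H' e le_rfl

lemma cexp_agree_eq_self {U : Finset (ℤ × ℤ)} (hU : U ⊆ inner R) {f : HeightFun R h → ℝ}
    (hf : ∀ z ∈ U, ∀ F F', (agree R h {z}).r F F' → f F' = f F) : cexp (agree R h U) f = f :=
  cexp_eq_self fun H H' e => eq_of_forall_agree_singleton hU hf H H' e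

end Heights

/-! ## Resampling on neighbouring blocks -/

section Coupling

variable {R : Finset (ℤ × ℤ)} {h : boundary R → ℤ} {U : Finset (ℤ × ℤ)} {f : HeightFun R h → ℝ}
  {δ ε : ℝ}

lemma eq_of_agree_singleton_of_ht_eq {z : ℤ × ℤ} {F G G' : HeightFun R h}
    (hG : (agree R h {z}).r F G) (hG' : (agree R h {z}).r F G') (e : ht G z = ht G' z) : G = G' :=
  eq_of_agree_of_ht ((agree R h {z}).iseqv.trans ((agree R h {z}).iseqv.symm hG) hG') e

lemma ave_sub_ave_self (s : Finset (HeightFun R h)) (hδ : 0 ≤ δ) : |ave s f - ave s f| ≤ δ := by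
  simpa using hδ

/-- If all vertices of `U` lie in one column and the height next to the end `(x, y)` of a run
is `q`, then conditioning the height at `(x, y)` to be `q` moves averages by at most half of
the effect of a single-site change. -/
lemma abs_ave_sub_ave_end_of_run {x s : ℤ} (hs : s = 1 ∨ s = -1) (n : ℕ) :
    ∀ U : Finset (ℤ × ℤ), U.card = n → U ⊆ inner R → (∀ z ∈ U, z.1 = x) →
    (∀ z ∈ U, ∀ F F' : HeightFun R h, (agree R h {z}).r F F' → |f F' - f F| ≤ δ) →
    ∀ y : ℤ, (x, y) ∈ U → ∀ H₀ : HeightFun R h,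
    (∀ F ∈ cls (agree R h U) H₀, ht F (x, y - s) = ht H₀ (x, y)) →
    |ave (cls (agree R h U) H₀) f -
      ave ((cls (agree R h U) H₀).filter fun F => ht F (x, y) = ht H₀ (x, y)) f| ≤ δ / 2 := by
  induction n with
  | zero =>
    intro U hn _ _ _ y hy
    rw [Finset.card_eq_zero.1 hn] at hy
    simp at hy
  | succ n ih =>
    intro U hn hU hx hf y hy H₀ hprev
    have hδ : 0 ≤ δ := (abs_nonneg _).trans (hf _ hy H₀ H₀ ((agree R h _).iseqv.refl _))
    set q := ht H₀ (x, y) with hq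
    set S₀ := cls (agree R h U) H₀ with hS₀
    have hin := hU hy
    have hmem : ∀ F, F ∈ S₀ ↔ (agree R h U).r H₀ F := fun F => mem_cls _
    have hcol : ∀ F ∈ S₀, ∀ x' ≠ x, ∀ y', ht F (x', y') = ht H₀ (x', y') := fun F hF x' hx' y' =>
      (((hmem F).1 hF) _ fun hz => hx' (hx _ hz)).symm
    by_cases hall : ∀ F ∈ S₀, ht F (x, y) = q
    · rw [Finset.filter_true_of_mem hall]
      exact ave_sub_ave_self _ (by linarith)
    push Not at hall
    obtain ⟨F₂, hF₂, hF₂q⟩ := hall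
    have hsingle : agree R h {(x, y)} ≤ agree R h U :=
      agree_mono (Finset.singleton_subset_iff.2 hy)
    have hupd : ∀ F ∈ S₀, ∀ F', (agree R h {(x, y)}).r F F' → F' ∈ S₀ := fun F hF F' hFF' =>
      (hmem _).2 ((agree R h U).iseqv.trans ((hmem F).1 hF) (hsingle hFF'))
    have hself : H₀ ∈ S₀ := self_mem_cls _ _
    -- The two adjacent columns are frozen on the class. A height at `(x, y)` other than `q` can
    -- only be `q - s`; the hexagon inequalities then force the next site to have height `q - s`
    -- too, and the site can be changed to `q`.
    have hcases : ∀ F ∈ S₀, ht F (x, y) ≠ q → ht F (x, y) = q - s ∧ ht F (x, y + s) = q - s ∧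
        Fits F x y q := by
      intro F hF hFq
      have a := fits_self F hin
      have b := fits_self H₀ hin
      have c := ht_hexagon F hin
      have p := hprev F hF
      have e1 := hcol F hF (x + 1) (by omega) y
      have e2 := hcol F hF (x + 1) (by omega) (y + 1)
      have e3 := hcol F hF (x - 1) (by omega) y
      have e4 := hcol F hF (x - 1) (by omega) (y - 1)
      obtain ⟨a1, a2, a3, a4, a5, a6⟩ := a
      obtain ⟨b1, b2, b3, b4, b5, b6⟩ := b
      rcases hs with rfl | rfl
      · refine ⟨by omega, by omega, ?_⟩
        constructor <;> omega
      · simp only [sub_neg_eq_add, ← sub_eq_add_neg] at p ⊢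
        refine ⟨by omega, by omega, ?_⟩
        constructor <;> omega
    -- Conversely, if the next site is not at `q`, then `(x, y)` can be changed back to `q - s`; the
    -- existence of `F₂` shows that the frozen columns allow this. So changes at `(x, y)` match `S₀
    -- \ S₁` with `S₁ \ S₂`.
    have hback : ∀ F ∈ S₀, ht F (x, y) = q → ht F (x, y + s) ≠ q →
        ht F (x, y + s) = q - s ∧ Fits F x y (q - s) := by
      intro F hF hFq hne
      have a := fits_self F hin
      have b := fits_self F₂ hin
      rw [(hcases F₂ hF₂ hF₂q).1] at b
      have p := hprev F hF
      have e1 := hcol F hF (x + 1) (by omega) y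
      have e2 := hcol F hF (x + 1) (by omega) (y + 1)
      have e3 := hcol F hF (x - 1) (by omega) y
      have e4 := hcol F hF (x - 1) (by omega) (y - 1)
      have e1' := hcol F₂ hF₂ (x + 1) (by omega) y
      have e2' := hcol F₂ hF₂ (x + 1) (by omega) (y + 1)
      have e3' := hcol F₂ hF₂ (x - 1) (by omega) y
      have e4' := hcol F₂ hF₂ (x - 1) (by omega) (y - 1)
      obtain ⟨a1, a2, a3, a4, a5, a6⟩ := a
      obtain ⟨b1, b2, b3, b4, b5, b6⟩ := b
      rcases hs with rfl | rfl
      · refine ⟨by omega, ?_⟩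
        constructor <;> omega
      · simp only [sub_neg_eq_add, ← sub_eq_add_neg] at p hne b1 b2 b3 b4 b5 b6 ⊢
        refine ⟨by omega, ?_⟩
        constructor <;> omega
    set S₁ := S₀.filter fun F => ht F (x, y) = q with hS₁
    set S₂ := S₁.filter fun F => ht F (x, y + s) = q with hS₂
    have hm1 : ∀ F, F ∈ S₁ ↔ F ∈ S₀ ∧ ht F (x, y) = q := fun F => by simp [hS₁]
    have hm2 : ∀ F, F ∈ S₂ ↔ F ∈ S₁ ∧ ht F (x, y + s) = q := fun F => by simp [hS₂]
    have hm01 : ∀ F, F ∈ S₀ \ S₁ ↔ F ∈ S₀ ∧ ht F (x, y) ≠ q := fun F => by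
      rw [Finset.mem_sdiff, hm1]; tauto
    have hm12 : ∀ F, F ∈ S₁ \ S₂ ↔ (F ∈ S₀ ∧ ht F (x, y) = q) ∧ ht F (x, y + s) ≠ q := fun F => by
      rw [Finset.mem_sdiff, hm2, hm1]; tauto
    have hys : ((x, y + s) : ℤ × ℤ) ∉ ({(x, y)} : Finset (ℤ × ℤ)) := by
      simp only [Finset.mem_singleton, Prod.mk.injEq, not_and]
      omega
    refine abs_ave_sub_ave_le_of_nested (fun F hF => ((hm1 F).1 hF).1) (fun F hF => ((hm2 F).1 hF).1)
      ⟨H₀, (hm1 _).2 ⟨hself, rfl⟩⟩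
      (sum_transport (agree R h {(x, y)}).r ?_ ?_ ?_ ?_ fun F _ F' _ hFF' => hf _ hy F F' hFF') ?_
    · intro F hF
      obtain ⟨hF0, hFq⟩ := (hm01 F).1 hF
      obtain ⟨-, hFs, hfit⟩ := hcases F hF0 hFq
      obtain ⟨F', hFF', hF'q⟩ := exists_update F hin hfit
      refine ⟨F', (hm12 _).2 ⟨⟨hupd F hF0 F' hFF', hF'q⟩, ?_⟩, hFF'⟩
      rw [← hFF' _ hys, hFs]
      omega
    · intro F' hF'
      obtain ⟨⟨hF'0, hF'q⟩, hF's⟩ := (hm12 F').1 hF'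
      obtain ⟨-, hfit⟩ := hback F' hF'0 hF'q hF's
      obtain ⟨F, hF'F, hFq⟩ := exists_update F' hin hfit
      refine ⟨F, (hm01 _).2 ⟨hupd F' hF'0 F hF'F, ?_⟩, (agree R h _).iseqv.symm hF'F⟩
      rw [hFq]
      omega
    · intro F _ G hG G' hG' hFG hFG'
      exact eq_of_agree_singleton_of_ht_eq hFG hFG'
        (((hm12 _).1 hG).1.2.trans ((hm12 _).1 hG').1.2.symm)
    · intro G hG G' hG' F _ hGF hG'F
      have e := fun K (hK : K ∈ S₀ \ S₁) => (hcases K ((hm01 K).1 hK).1 ((hm01 K).1 hK).2).1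
      exact eq_of_agree_singleton_of_ht_eq ((agree R h _).iseqv.symm hGF)
        ((agree R h _).iseqv.symm hG'F) ((e G hG).trans (e G' hG').symm)
    -- `S₁` is itself a class, with `(x, y)` frozen at `q`, and `S₂` conditions its next site to be
    -- `q`. This is the same situation, with `(x, y)` removed from `U` and the end of the run moved
    -- by `s`.
    · rintro ⟨F₃, hF₃⟩
      obtain ⟨hF₃1, hF₃s⟩ := (hm2 _).1 hF₃
      obtain ⟨hF₃0, hF₃q⟩ := (hm1 _).1 hF₃1
      have hyU : (x, y + s) ∈ U := by
        by_contra hyU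
        have e1 := ((hmem _).1 hF₂) _ hyU
        have e2 := ((hmem _).1 hF₃0) _ hyU
        have e3 := (hcases F₂ hF₂ hF₂q).2.1
        omega
      have hcls : cls (agree R h (U.erase (x, y))) F₃ = S₁ := by
        ext F
        rw [mem_cls, hm1, hmem]
        constructor
        · intro e
          exact ⟨(agree R h U).iseqv.trans ((hmem _).1 hF₃0)
            (agree_mono (Finset.erase_subset _ _) e),
            (e _ (Finset.notMem_erase _ _)).symm.trans hF₃q⟩
        · rintro ⟨e, e'⟩ z hz
          by_cases hzy : z = (x, y)
          · rw [hzy, hF₃q, e']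
          · have hzU : z ∉ U := fun hzU => hz (Finset.mem_erase.2 ⟨hzy, hzU⟩)
            rw [← (hmem _).1 hF₃0 _ hzU, ← e _ hzU]
      have hne : (x, y + s) ≠ (x, y) := fun e => hys (by rw [e]; simp)
      have := ih (U.erase (x, y)) (by rw [Finset.card_erase_of_mem hy, hn]; simp)
        ((Finset.erase_subset _ _).trans hU) (fun z hz => hx z (Finset.mem_of_mem_erase hz))
        (fun z hz => hf z (Finset.mem_of_mem_erase hz)) (y + s) (Finset.mem_erase.2 ⟨hne, hyU⟩) F₃
        (fun F hF => by
          rw [hcls, hm1] at hF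
          rw [add_sub_cancel_right, hF.2, hF₃s])
      rwa [hcls, hF₃s] at this

/-- Since `A` or `B` is the whole set, only one of the two conditioning errors occurs, which is why
the cost is `δ / 2` rather than `δ`. -/
lemma abs_ave_sub_ave_le_of_subsets {Ω : Type} {S₁ S₂ A B : Finset Ω} {f : Ω → ℝ}
    (hA : |ave S₁ f - ave A f| ≤ δ / 2) (hB : |ave S₂ f - ave B f| ≤ δ / 2)
    (hex : A = S₁ ∨ B = S₂) (hAB : |ave B f - ave A f| ≤ ε) : |ave S₂ f - ave S₁ f| ≤ ε + δ / 2 := by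
  rw [abs_le] at *
  rcases hex with rfl | rfl <;> constructor <;> linarith

lemma mem_of_ht_ne {H F : HeightFun R h} (hF : F ∈ cls (agree R h U) H) {z : ℤ × ℤ}
    (hz : ht F z ≠ ht H z) : z ∈ U := by
  by_contra hU
  exact hz ((mem_cls _).1 hF z hU).symm

lemma mem_cls_of_agree {v : ℤ × ℤ} {H₁ H₂ F F' : HeightFun R h}
    (h₁₂ : (agree R h {v}).r H₁ H₂) (hF : F ∈ cls (agree R h U) H₁)
    (hFF' : (agree R h {v}).r F F') (hF' : ht F' v = ht H₂ v) : F' ∈ cls (agree R h U) H₂ := by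
  rw [mem_cls] at *
  intro z hz
  by_cases hzv : z = v
  · rw [hzv, hF']
  · have hzv' : z ∉ ({v} : Finset (ℤ × ℤ)) := by simpa using hzv
    rw [← h₁₂ z hzv', ← hFF' z hzv', hF z hz]

/-- Averages over two classes are close if single-site changes at `v` match subsets of them. -/
lemma abs_ave_sub_ave_le_of_agree {v : ℤ × ℤ} (hv : v ∉ U) {H₁ H₂ : HeightFun R h}
    (h₁₂ : (agree R h {v}).r H₁ H₂) {p₁ p₂ : HeightFun R h → Prop}
    [DecidablePred p₁] [DecidablePred p₂] (hp₁ : p₁ H₁)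
    (hε : ∀ F F', (agree R h {v}).r F F' → |f F' - f F| ≤ ε)
    (t₁ : ∀ F ∈ cls (agree R h U) H₁, p₁ F →
      ∃ F', (agree R h {v}).r F F' ∧ ht F' v = ht H₂ v ∧ p₂ F')
    (t₂ : ∀ F ∈ cls (agree R h U) H₂, p₂ F →
      ∃ F', (agree R h {v}).r F F' ∧ ht F' v = ht H₁ v ∧ p₁ F') :
    |ave ((cls (agree R h U) H₂).filter p₂) f - ave ((cls (agree R h U) H₁).filter p₁) f| ≤ ε := by
  refine abs_ave_sub_ave_le_of_transport
    ⟨H₁, Finset.mem_filter.2 ⟨self_mem_cls _ _, hp₁⟩⟩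
    (sum_transport (agree R h {v}).r ?_ ?_ ?_ ?_ fun F _ F' _ e => hε F F' e)
  · intro F hF
    obtain ⟨hF, hFp⟩ := Finset.mem_filter.1 hF
    obtain ⟨F', e, ev, hF'p⟩ := t₁ F hF hFp
    exact ⟨F', Finset.mem_filter.2 ⟨mem_cls_of_agree h₁₂ hF e ev, hF'p⟩, e⟩
  · intro F hF
    obtain ⟨hF, hFp⟩ := Finset.mem_filter.1 hF
    obtain ⟨F', e, ev, hF'p⟩ := t₂ F hF hFp
    exact ⟨F', Finset.mem_filter.2 ⟨mem_cls_of_agree ((agree R h _).iseqv.symm h₁₂) hF e ev,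
      hF'p⟩, (agree R h _).iseqv.symm e⟩
  · intro F _ G hG G' hG' e e'
    refine eq_of_agree_singleton_of_ht_eq e e' ?_
    rw [← (mem_cls _).1 (Finset.mem_filter.1 hG).1 v hv,
      ← (mem_cls _).1 (Finset.mem_filter.1 hG').1 v hv]
  · intro G hG G' hG' F _ e e'
    refine eq_of_agree_singleton_of_ht_eq ((agree R h _).iseqv.symm e)
      ((agree R h _).iseqv.symm e') ?_
    rw [← (mem_cls _).1 (Finset.mem_filter.1 hG).1 v hv,
      ← (mem_cls _).1 (Finset.mem_filter.1 hG').1 v hv]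

/-- The vertex `v` has two neighbours `(x, m)` and `(x, m')` in the column. Its lower height forces
the first to be `q`, its higher height forces the second to be `q`. Once both are `q`, changing the
height at `v` is a bijection between the conditioned classes. Conditioning the free neighbour costs
`δ / 2` by the run estimate, and `hex` says that only one side needs it. -/
lemma column_coupling {x m m' q : ℤ} (hm : m' = m + 1) (hU : U ⊆ inner R) (hx : ∀ z ∈ U, z.1 = x)
    (hδ : 0 ≤ δ) (hf : ∀ z ∈ U, ∀ F F', (agree R h {z}).r F F' → |f F' - f F| ≤ δ) {v : ℤ × ℤ}
    (hv : v.1 ≠ x) {H₁ H₂ : HeightFun R h} (h₁₂ : (agree R h {v}).r H₁ H₂)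
    (hε : ∀ F F', (agree R h {v}).r F F' → |f F' - f F| ≤ ε)
    (hA : ∀ F ∈ cls (agree R h U) H₁, ht F (x, m) = q)
    (hB : ∀ F ∈ cls (agree R h U) H₂, ht F (x, m') = q)
    (t₁ : ∀ F ∈ cls (agree R h U) H₁, ht F (x, m') = q →
      ∃ F', (agree R h {v}).r F F' ∧ ht F' v = ht H₂ v)
    (t₂ : ∀ F ∈ cls (agree R h U) H₂, ht F (x, m) = q →
      ∃ F', (agree R h {v}).r F F' ∧ ht F' v = ht H₁ v)
    (hex : ∀ F ∈ cls (agree R h U) H₁, ∀ F' ∈ cls (agree R h U) H₂, ht F (x, m') ≠ q →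
      ht F' (x, m) ≠ q → (x, m') ∈ U → (x, m) ∈ U → False) :
    |cexp (agree R h U) f H₂ - cexp (agree R h U) f H₁| ≤ ε + δ / 2 := by
  have hvU : v ∉ U := fun e => hv (hx v e)
  have hvx : ∀ y, (x, y) ∉ ({v} : Finset (ℤ × ℤ)) := fun y e => hv (by
    rw [Finset.mem_singleton] at e
    rw [← e])
  have q₁ : ht H₁ (x, m') = q := (h₁₂ _ (hvx _)).trans (hB _ (self_mem_cls _ _))
  have q₂ : ht H₂ (x, m) = q := (h₁₂ _ (hvx _)).symm.trans (hA _ (self_mem_cls _ _))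
  refine abs_ave_sub_ave_le_of_subsets (A := (cls (agree R h U) H₁).filter fun F => ht F (x, m') = q)
    (B := (cls (agree R h U) H₂).filter fun F => ht F (x, m) = q) ?_ ?_ ?_ ?_
  · by_cases hall : ∀ F ∈ cls (agree R h U) H₁, ht F (x, m') = q
    · rw [Finset.filter_true_of_mem hall]
      exact ave_sub_ave_self _ (by linarith)
    · push Not at hall
      obtain ⟨F, hF, hFq⟩ := hall
      rw [← q₁]
      refine abs_ave_sub_ave_end_of_run (s := 1) (Or.inl rfl) _ U rfl hU hx hf m'
        (mem_of_ht_ne hF (by rwa [q₁])) H₁ fun G hG => ?_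
      rw [q₁, hm, add_sub_cancel_right, hA G hG]
  · by_cases hall : ∀ F ∈ cls (agree R h U) H₂, ht F (x, m) = q
    · rw [Finset.filter_true_of_mem hall]
      exact ave_sub_ave_self _ (by linarith)
    · push Not at hall
      obtain ⟨F, hF, hFq⟩ := hall
      rw [← q₂]
      refine abs_ave_sub_ave_end_of_run (s := -1) (Or.inr rfl) _ U rfl hU hx hf m
        (mem_of_ht_ne hF (by rwa [q₂])) H₂ fun G hG => ?_
      rw [q₂, sub_neg_eq_add, ← hm, hB G hG]
  · by_contra! hcon
    obtain ⟨F, hF, hFq⟩ : ∃ F ∈ cls (agree R h U) H₁, ht F (x, m') ≠ q := by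
      by_contra! hall
      exact hcon.1 (Finset.filter_true_of_mem hall)
    obtain ⟨F', hF', hF'q⟩ : ∃ F ∈ cls (agree R h U) H₂, ht F (x, m) ≠ q := by
      by_contra! hall
      exact hcon.2 (Finset.filter_true_of_mem hall)
    exact hex F hF F' hF' hFq hF'q (mem_of_ht_ne hF (by rwa [q₁])) (mem_of_ht_ne hF' (by rwa [q₂]))
  · refine abs_ave_sub_ave_le_of_agree (p₁ := fun F => ht F (x, m') = q)
      (p₂ := fun F => ht F (x, m) = q) hvU h₁₂ q₁ hε (fun F hF hFq => ?_) fun F hF hFq => ?_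
    · obtain ⟨F', e, e'⟩ := t₁ F hF hFq
      exact ⟨F', e, e', (e _ (hvx _)).symm.trans (hA F hF)⟩
    · obtain ⟨F', e, e'⟩ := t₂ F hF hFq
      exact ⟨F', e, e', (e _ (hvx _)).symm.trans (hB F hF)⟩

/-- A symmetric estimate for height functions that agree off an interior vertex follows from the
case where the second one is larger by one. -/
lemma of_agree_singleton {v : ℤ × ℤ} (hv : v ∈ inner R) {g : HeightFun R h → ℝ} {c : ℝ} (hc : 0 ≤ c)
    (key : ∀ H₁ H₂, (agree R h {v}).r H₁ H₂ → ht H₂ v = ht H₁ v + 1 → |g H₂ - g H₁| ≤ c)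
    {H₁ H₂ : HeightFun R h} (h₁₂ : (agree R h {v}).r H₁ H₂) : |g H₂ - g H₁| ≤ c := by
  obtain ⟨x, y⟩ := v
  have a := (fits_self H₁ hv).right
  have b := (fits_self H₂ hv).right
  have e := h₁₂ (x + 1, y) (by simp)
  rcases lt_trichotomy (ht H₁ (x, y)) (ht H₂ (x, y)) with hlt | heq | hlt
  · exact key H₁ H₂ h₁₂ (by omega)
  · rw [eq_of_agree_of_ht h₁₂ heq]
    simpa using hc
  · rw [abs_sub_comm]
    exact key H₂ H₁ ((agree R h _).iseqv.symm h₁₂) (by omega)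

set_option maxHeartbeats 1600000 in
lemma abs_cexp_sub_cexp_le_of_column_right {x y : ℤ} (hU : U ⊆ inner R)
    (hx : ∀ z ∈ U, z.1 = x + 1)
    (hδ : 0 ≤ δ) (hf : ∀ z ∈ U, ∀ F F', (agree R h {z}).r F F' → |f F' - f F| ≤ δ)
    (hv : (x, y) ∈ inner R) (hε : ∀ F F', (agree R h {(x, y)}).r F F' → |f F' - f F| ≤ ε)
    {H₁ H₂ : HeightFun R h} (h₁₂ : (agree R h {(x, y)}).r H₁ H₂) :
    |cexp (agree R h U) f H₂ - cexp (agree R h U) f H₁| ≤ ε + δ / 2 := by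
  have hε0 : 0 ≤ ε := (abs_nonneg _).trans (hε H₁ H₂ h₁₂)
  refine of_agree_singleton hv (by linarith) (fun H₁ H₂ h₁₂ hlt => ?_) h₁₂
  have hcol : ∀ H F, F ∈ cls (agree R h U) H → ∀ x' ≠ x + 1, ∀ y',
      ht F (x', y') = ht H (x', y') :=
    fun H F hF x' hx' y' => ((mem_cls _).1 hF _ fun hz => hx' (hx _ hz)).symm
  have hH : ht H₁ (x, y - 1) = ht H₁ (x, y) + 1 ∧ ht H₁ (x, y + 1) = ht H₁ (x, y) ∧
      ht H₁ (x - 1, y) = ht H₁ (x, y) ∧ ht H₁ (x - 1, y - 1) = ht H₁ (x, y) ∧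
      ht H₂ (x, y - 1) = ht H₁ (x, y) + 1 ∧ ht H₂ (x, y + 1) = ht H₁ (x, y) ∧
      ht H₂ (x - 1, y) = ht H₁ (x, y) ∧ ht H₂ (x - 1, y - 1) = ht H₁ (x, y) := by
    have d2 := h₁₂ (x, y - 1) (by simp)
    have d4 := h₁₂ (x - 1, y) (by simp)
    have d5 := h₁₂ (x, y + 1) (by simp)
    have d6 := h₁₂ (x - 1, y - 1) (by simp)
    obtain ⟨-, a2, -, a4, a5, a6⟩ := fits_self H₁ hv
    obtain ⟨-, b2, -, b4, b5, b6⟩ := fits_self H₂ hv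
    omega
  obtain ⟨c1, c2, c3, c4, d1, d2, d3, d4⟩ := hH
  have hF₁ : ∀ F ∈ cls (agree R h U) H₁, ht F (x, y) = ht H₁ (x, y) ∧
      ht F (x + 1, y) = ht H₁ (x, y) + 1 ∧
      (ht F (x + 1, y + 1) = ht H₁ (x, y) + 1 → Fits F x y (ht H₁ (x, y) + 1)) := by
    intro F hF
    have g := (fits_self F hv).right
    have k := (ht_hexagon F hv).1
    have e0 := hcol _ F hF x (by omega) y
    have e1 := hcol _ F hF x (by omega) (y - 1)
    have e2 := hcol _ F hF x (by omega) (y + 1)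
    have e3 := hcol _ F hF (x - 1) (by omega) y
    have e4 := hcol _ F hF (x - 1) (by omega) (y - 1)
    exact ⟨by omega, by omega, fun e =>
      ⟨by omega, by omega, by omega, by omega, by omega, by omega⟩⟩
  have hF₂ : ∀ F ∈ cls (agree R h U) H₂, ht F (x, y) = ht H₁ (x, y) + 1 ∧
      ht F (x + 1, y + 1) = ht H₁ (x, y) + 1 ∧
      (ht F (x + 1, y) = ht H₁ (x, y) + 1 → Fits F x y (ht H₁ (x, y))) := by
    intro F hF
    have g := (fits_self F hv).upRight
    have k := (ht_hexagon F hv).2.2.1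
    have e0 := hcol _ F hF x (by omega) y
    have e1 := hcol _ F hF x (by omega) (y - 1)
    have e2 := hcol _ F hF x (by omega) (y + 1)
    have e3 := hcol _ F hF (x - 1) (by omega) y
    have e4 := hcol _ F hF (x - 1) (by omega) (y - 1)
    exact ⟨by omega, by omega, fun e =>
      ⟨by omega, by omega, by omega, by omega, by omega, by omega⟩⟩
  refine column_coupling (m := y) (m' := y + 1) rfl hU hx hδ hf
    (by simp : x ≠ x + 1) h₁₂ hε (fun F hF => (hF₁ F hF).2.1) (fun F hF => (hF₂ F hF).2.1)
    (fun F hF e => exists_update F hv (hlt ▸ (hF₁ F hF).2.2 e))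
    (fun F hF e => exists_update F hv ((hF₂ F hF).2.2 e)) ?_
  -- Both sites of the column are adjacent to `(x + 2, y + 1)`, whose height is frozen and common to
  -- the two classes. The two deviations from `q` have opposite signs and require incompatible
  -- heights there.
  intro F hF F' hF' hq hq' hm' hm
  have g := (fits_self F hv).upRight
  have g' := (fits_self F' hv).right
  have k := (fits_self F (hU hm')).right
  have k' := (fits_self F' (hU hm)).upRight
  have e1 := (hF₁ F hF).1
  have e2 := (hF₂ F' hF').1
  have e3 := hcol _ F hF (x + 1 + 1) (by omega) (y + 1)
  have e4 := hcol _ F' hF' (x + 1 + 1) (by omega) (y + 1)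
  have e5 := h₁₂ (x + 1 + 1, y + 1) (by simp)
  omega

set_option maxHeartbeats 1600000 in
lemma abs_cexp_sub_cexp_le_of_column_left {x y : ℤ} (hU : U ⊆ inner R)
    (hx : ∀ z ∈ U, z.1 = x - 1)
    (hδ : 0 ≤ δ) (hf : ∀ z ∈ U, ∀ F F', (agree R h {z}).r F F' → |f F' - f F| ≤ δ)
    (hv : (x, y) ∈ inner R) (hε : ∀ F F', (agree R h {(x, y)}).r F F' → |f F' - f F| ≤ ε)
    {H₁ H₂ : HeightFun R h} (h₁₂ : (agree R h {(x, y)}).r H₁ H₂) :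
    |cexp (agree R h U) f H₂ - cexp (agree R h U) f H₁| ≤ ε + δ / 2 := by
  have hε0 : 0 ≤ ε := (abs_nonneg _).trans (hε H₁ H₂ h₁₂)
  refine of_agree_singleton hv (by linarith) (fun H₁ H₂ h₁₂ hlt => ?_) h₁₂
  have hcol : ∀ H F, F ∈ cls (agree R h U) H → ∀ x' ≠ x - 1, ∀ y',
      ht F (x', y') = ht H (x', y') :=
    fun H F hF x' hx' y' => ((mem_cls _).1 hF _ fun hz => hx' (hx _ hz)).symm
  have hH : ht H₁ (x, y - 1) = ht H₁ (x, y) + 1 ∧ ht H₁ (x, y + 1) = ht H₁ (x, y) ∧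
      ht H₁ (x + 1, y) = ht H₁ (x, y) + 1 ∧ ht H₁ (x + 1, y + 1) = ht H₁ (x, y) + 1 ∧
      ht H₂ (x, y - 1) = ht H₁ (x, y) + 1 ∧ ht H₂ (x, y + 1) = ht H₁ (x, y) ∧
      ht H₂ (x + 1, y) = ht H₁ (x, y) + 1 ∧ ht H₂ (x + 1, y + 1) = ht H₁ (x, y) + 1 := by
    have d2 := h₁₂ (x, y - 1) (by simp)
    have d4 := h₁₂ (x + 1, y) (by simp)
    have d5 := h₁₂ (x, y + 1) (by simp)
    have d6 := h₁₂ (x + 1, y + 1) (by simp)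
    obtain ⟨a1, a2, a3, -, a5, -⟩ := fits_self H₁ hv
    obtain ⟨b1, b2, b3, -, b5, -⟩ := fits_self H₂ hv
    omega
  obtain ⟨c1, c2, c3, c4, d1, d2, d3, d4⟩ := hH
  have hF₁ : ∀ F ∈ cls (agree R h U) H₁, ht F (x, y) = ht H₁ (x, y) ∧
      ht F (x - 1, y - 1) = ht H₁ (x, y) ∧
      (ht F (x - 1, y) = ht H₁ (x, y) → Fits F x y (ht H₁ (x, y) + 1)) := by
    intro F hF
    have g := (fits_self F hv).downLeft
    have k := (ht_hexagon F hv).2.2.2.2.2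
    have e0 := hcol _ F hF x (by omega) y
    have e1 := hcol _ F hF x (by omega) (y - 1)
    have e2 := hcol _ F hF x (by omega) (y + 1)
    have e3 := hcol _ F hF (x + 1) (by omega) y
    have e4 := hcol _ F hF (x + 1) (by omega) (y + 1)
    exact ⟨by omega, by omega, fun e =>
      ⟨by omega, by omega, by omega, by omega, by omega, by omega⟩⟩
  have hF₂ : ∀ F ∈ cls (agree R h U) H₂, ht F (x, y) = ht H₁ (x, y) + 1 ∧
      ht F (x - 1, y) = ht H₁ (x, y) ∧
      (ht F (x - 1, y - 1) = ht H₁ (x, y) → Fits F x y (ht H₁ (x, y))) := by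
    intro F hF
    have g := (fits_self F hv).left
    have k := (ht_hexagon F hv).2.2.2.1
    have e0 := hcol _ F hF x (by omega) y
    have e1 := hcol _ F hF x (by omega) (y - 1)
    have e2 := hcol _ F hF x (by omega) (y + 1)
    have e3 := hcol _ F hF (x + 1) (by omega) y
    have e4 := hcol _ F hF (x + 1) (by omega) (y + 1)
    exact ⟨by omega, by omega, fun e =>
      ⟨by omega, by omega, by omega, by omega, by omega, by omega⟩⟩
  refine column_coupling (m := y - 1) (m' := y) (by ring) hU hx hδ hf
    (by simp only; omega) h₁₂ hε (fun F hF => (hF₁ F hF).2.1) (fun F hF => (hF₂ F hF).2.1)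
    (fun F hF e => exists_update F hv (hlt ▸ (hF₁ F hF).2.2 e))
    (fun F hF e => exists_update F hv ((hF₂ F hF).2.2 e)) ?_
  -- As for the right column, with the common neighbour `(x - 2, y - 1)`.
  intro F hF F' hF' hq hq' hm' hm
  have g := (fits_self F hv).left
  have g' := (fits_self F' hv).downLeft
  have k := (fits_self F (hU hm')).downLeft
  have k' := (fits_self F' (hU hm)).left
  have e1 := (hF₁ F hF).1
  have e2 := (hF₂ F' hF').1
  have e3 := hcol _ F hF (x - 1 - 1) (by omega) (y - 1)
  have e4 := hcol _ F' hF' (x - 1 - 1) (by omega) (y - 1)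
  have e5 := h₁₂ (x - 1 - 1, y - 1) (by simp)
  omega

end Coupling

/-! ### Spectral gaps for blocks arranged in a line -/

section Ladder

variable {R : Finset (ℤ × ℤ)} {h : boundary R → ℤ} {U : Finset (ℤ × ℤ)} {f : HeightFun R h → ℝ}
  {δ ε : ℝ}

/-- Conditioning on the height at a single resampled site moves averages by at most half of the
effect of a single-site change. -/
lemma abs_ave_sub_ave_of_singleton {u : ℤ × ℤ} (hu : u ∈ inner R)
    (hf : ∀ F F', (agree R h {u}).r F F' → |f F' - f F| ≤ δ) (H : HeightFun R h) :
    |ave (cls (agree R h {u}) H) f -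
      ave ((cls (agree R h {u}) H).filter fun F => ht F u = ht H u) f| ≤ δ / 2 := by
  have hδ : 0 ≤ δ := (abs_nonneg _).trans (hf H H ((agree R h _).iseqv.refl _))
  by_cases hall : ∀ F ∈ cls (agree R h {u}) H, ht F u = ht H u
  · rw [Finset.filter_true_of_mem hall]
    exact ave_sub_ave_self _ (by linarith)
  push Not at hall
  obtain ⟨F₂, hF₂, hF₂u⟩ := hall
  have hm0 : ∀ F, F ∈ cls (agree R h {u}) H ↔ (agree R h {u}).r H F := fun F => mem_cls _
  have h₁ : ∀ F, F ∈ (cls (agree R h {u}) H).filter (fun F => ht F u = ht H u) ↔ F = H := by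
    intro F
    rw [Finset.mem_filter, hm0]
    constructor
    · rintro ⟨e, e'⟩
      exact (eq_of_agree_of_ht e e'.symm).symm
    · rintro rfl
      exact ⟨(agree R h _).iseqv.refl _, rfl⟩
  have h₀₁ : ∀ F, F ∈ cls (agree R h {u}) H \ (cls (agree R h {u}) H).filter
      (fun F => ht F u = ht H u) ↔ (agree R h {u}).r H F ∧ ht F u ≠ ht H u := by
    intro F
    rw [Finset.mem_sdiff, Finset.mem_filter, hm0]
    tauto
  obtain ⟨x, y⟩ := u
  -- The class has exactly two elements here, so the chain of nested sets ends at once.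
  refine abs_ave_sub_ave_le_of_nested (S₂ := ∅) (Finset.filter_subset _ _) (by simp)
    ⟨H, (h₁ H).2 rfl⟩ ?_ (by simp)
  rw [Finset.sdiff_empty]
  refine sum_transport (agree R h {(x, y)}).r ?_ ?_ ?_ ?_ fun F _ F' _ e => hf F F' e
  · intro F hF
    exact ⟨H, (h₁ H).2 rfl, (agree R h _).iseqv.symm ((h₀₁ F).1 hF).1⟩
  · intro F hF
    rw [(h₁ F).1 hF]
    exact ⟨F₂, (h₀₁ _).2 ⟨(hm0 _).1 hF₂, hF₂u⟩, (agree R h _).iseqv.symm ((hm0 _).1 hF₂)⟩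
  · intro F _ G hG G' hG' _ _
    rw [(h₁ G).1 hG, (h₁ G').1 hG']
  · intro F hF F' hF' _ _ _ _
    obtain ⟨e, n⟩ := (h₀₁ F).1 hF
    obtain ⟨e', n'⟩ := (h₀₁ F').1 hF'
    refine eq_of_agree_singleton_of_ht_eq e e' ?_
    have g := (fits_self H hu).right
    have g₁ := (fits_self F hu).right
    have g₂ := (fits_self F' hu).right
    have k := (fits_self H hu).left
    have k₁ := (fits_self F hu).left
    have k₂ := (fits_self F' hu).left
    have := e (x + 1, y) (by simp)
    have := e' (x + 1, y) (by simp)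
    omega

/-- The right neighbour leaves two possible heights at `(x, y')`. For consecutive heights at `(x,
y)` only one height at `(x, y')` is allowed in both cases, so at least one of the two classes is a
single point, and only one conditioning error is paid. -/
lemma abs_cexp_sub_cexp_le_of_vertical {x y y' : ℤ} (hy : y' = y + 1 ∨ y' = y - 1)
    (hu : (x, y') ∈ inner R) (hv : (x, y) ∈ inner R)
    (hf : ∀ F F', (agree R h {(x, y')}).r F F' → |f F' - f F| ≤ δ)
    (hε : ∀ F F', (agree R h {(x, y)}).r F F' → |f F' - f F| ≤ ε)
    {H₁ H₂ : HeightFun R h} (h₁₂ : (agree R h {(x, y)}).r H₁ H₂) :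
    |cexp (agree R h {(x, y')}) f H₂ - cexp (agree R h {(x, y')}) f H₁| ≤ ε + δ / 2 := by
  have hδ : 0 ≤ δ := (abs_nonneg _).trans (hf H₁ H₁ ((agree R h _).iseqv.refl _))
  have hε0 : 0 ≤ ε := (abs_nonneg _).trans (hε H₁ H₂ h₁₂)
  refine of_agree_singleton hv (by linarith) (fun H₁ H₂ h₁₂ hlt => ?_) h₁₂
  have huv : (x, y') ∉ ({(x, y)} : Finset (ℤ × ℤ)) := by
    simp only [Finset.mem_singleton, Prod.mk.injEq, true_and]
    omega
  have hvu : (x, y) ∉ ({(x, y')} : Finset (ℤ × ℤ)) := by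
    simp only [Finset.mem_singleton, Prod.mk.injEq, true_and]
    omega
  have hH : ∀ H F, F ∈ cls (agree R h {(x, y')}) H → ht F (x, y') = ht H (x, y') → F = H :=
    fun H F hF e => (eq_of_agree_of_ht ((mem_cls _).1 hF) e.symm).symm
  refine abs_ave_sub_ave_le_of_subsets (abs_ave_sub_ave_of_singleton hu hf H₁)
    (abs_ave_sub_ave_of_singleton hu hf H₂) ?_
    (abs_ave_sub_ave_le_of_agree (p₁ := fun F => ht F (x, y') = ht H₁ (x, y'))
      (p₂ := fun F => ht F (x, y') = ht H₂ (x, y')) hvu h₁₂ rfl hε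
      (fun F hF e => ⟨H₂, (hH _ F hF e).symm ▸ h₁₂, rfl, rfl⟩)
      (fun F hF e => ⟨H₁, (hH _ F hF e).symm ▸ (agree R h _).iseqv.symm h₁₂, rfl, rfl⟩))
  by_contra! hcon
  obtain ⟨F, hF, hFq⟩ : ∃ F ∈ cls (agree R h {(x, y')}) H₁, ht F (x, y') ≠ ht H₁ (x, y') := by
    by_contra! hall
    exact hcon.1 (Finset.filter_true_of_mem hall)
  obtain ⟨F', hF', hF'q⟩ : ∃ F ∈ cls (agree R h {(x, y')}) H₂, ht F (x, y') ≠ ht H₂ (x, y') := by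
    by_contra! hall
    exact hcon.2 (Finset.filter_true_of_mem hall)
  rw [mem_cls] at hF hF'
  have e0 := hF _ hvu
  have e1 := hF' _ hvu
  have e2 := h₁₂ _ huv
  have e3 := hF (x + 1, y') (by simp)
  have e4 := hF' (x + 1, y') (by simp)
  have e5 := h₁₂ (x + 1, y') (by simp)
  have g := (fits_self F hu).right
  have g' := (fits_self F' hu).right
  rcases hy with rfl | rfl
  · have k := (fits_self F hv).up
    have k' := (fits_self F' hv).up
    have l := (fits_self H₁ hv).up
    have l' := (fits_self H₂ hv).up
    omega
  · have k := (fits_self F hv).down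
    have k' := (fits_self F' hv).down
    have l := (fits_self H₁ hv).down
    have l' := (fits_self H₂ hv).down
    omega

/-- The constraints at `v` involve no resampled site, so changing the height at `v` is a bijection
between the two classes. -/
lemma abs_cexp_sub_cexp_le_of_not_adj {v : ℤ × ℤ} (hv : v ∈ inner R) (hvU : v ∉ U)
    (hadj : ∀ w ∈ U, ¬ triLattice.Adj v w)
    (hε : ∀ F F', (agree R h {v}).r F F' → |f F' - f F| ≤ ε)
    {H₁ H₂ : HeightFun R h} (h₁₂ : (agree R h {v}).r H₁ H₂) :
    |cexp (agree R h U) f H₂ - cexp (agree R h U) f H₁| ≤ ε := by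
  obtain ⟨x, y⟩ := v
  have key : ∀ H₁ H₂ : HeightFun R h, (agree R h {(x, y)}).r H₁ H₂ →
      ∀ F ∈ cls (agree R h U) H₁, Fits F x y (ht H₂ (x, y)) := by
    intro H₁ H₂ h₁₂ F hF
    have hn : ∀ w, triLattice.Adj (x, y) w → ht F w = ht H₂ w := fun w hw => by
      rw [← (mem_cls _).1 hF w fun hwU => hadj w hwU hw]
      exact h₁₂ w (by simpa using hw.ne')
    obtain ⟨a1, a2, a3, a4, a5, a6⟩ := fits_self H₂ hv
    constructor <;> rw [hn _ (by simp [triLattice])] <;> assumption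
  have := abs_ave_sub_ave_le_of_agree (p₁ := fun _ => True) (p₂ := fun _ => True) hvU h₁₂ trivial hε
    (fun F hF _ => by simpa using exists_update F hv (key H₁ H₂ h₁₂ F hF))
    (fun F hF _ => by
      simpa using exists_update F hv (key H₂ H₁ ((agree R h _).iseqv.symm h₁₂) F hF))
  simp only [Finset.filter_true] at this
  exact this

/-- With `W = (j - lo) * (hi - j)`, the own block saves `M * W` while the two neighbours cost half
of their weights, together `M * (W - 1)`. The net gain `M` is at least `4 / (hi - lo) ^ 2 * (M *
W)`, because `W ≤ (hi - lo) ^ 2 / 4`. -/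
lemma ladder_weight_sum {lo hi j : ℤ} (h₁ : lo < j) (h₂ : j < hi) {M : ℝ} (hM : 0 ≤ M)
    {b : ℤ → ℝ} (hbj : b j ≤ 0)
    (hb1 : ∀ i, i = j + 1 ∨ i = j - 1 →
      b i ≤ M * ((j - lo) * (hi - j)) + M * ((i - lo) * (hi - i)) / 2)
    (hb : ∀ i, i ≠ j → i ≠ j + 1 → i ≠ j - 1 → b i ≤ M * ((j - lo) * (hi - j))) :
    ∑ i ∈ Finset.Ioo lo hi, b i ≤
      ((Finset.Ioo lo hi).card - 4 / ((hi : ℝ) - lo) ^ 2) * (M * ((j - lo) * (hi - j))) := by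
  have r1 : (lo : ℝ) + 1 ≤ j := by exact_mod_cast h₁
  have r2 : (j : ℝ) + 1 ≤ hi := by exact_mod_cast h₂
  set W : ℝ := (j - lo) * (hi - j) with hW
  have hW0 : 0 ≤ W := mul_nonneg (by linarith) (by linarith)
  set W₁ : ℝ := (j + 1 - lo) * (hi - (j + 1)) with hW₁
  set W₂ : ℝ := (j - 1 - lo) * (hi - (j - 1)) with hW₂
  have hW₁0 : 0 ≤ W₁ := mul_nonneg (by linarith) (by linarith)
  have hW₂0 : 0 ≤ W₂ := mul_nonneg (by linarith) (by linarith)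
  have hpt : ∀ i ∈ Finset.Ioo lo hi, b i ≤ M * W - (if i = j then M * W else 0) +
      (if i = j + 1 then M * W₁ / 2 else 0) + (if i = j - 1 then M * W₂ / 2 else 0) := by
    intro i _
    by_cases e : i = j
    · subst e
      have n1 : i ≠ i - 1 := by omega
      simpa [n1] using hbj
    by_cases e1 : i = j + 1
    · subst e1
      have := hb1 (j + 1) (Or.inl rfl)
      have n1 : j + 1 ≠ j - 1 := by omega
      push_cast at this
      simpa [n1] using this
    by_cases e2 : i = j - 1
    · subst e2
      have := hb1 (j - 1) (Or.inr rfl)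
      have n1 : j - 1 ≠ j + 1 := by omega
      push_cast at this
      simpa [n1] using this
    simpa [e, e1, e2] using hb i e e1 e2
  have hind : ∀ (k : ℤ) (c : ℝ), 0 ≤ c →
      ∑ i ∈ Finset.Ioo lo hi, (if i = k then c else 0) ≤ c := fun k c hc => by
    rw [Finset.sum_ite_eq']
    split_ifs <;> simp [hc]
  have hj : ∑ i ∈ Finset.Ioo lo hi, (if i = j then M * W else 0) = M * W := by
    rw [Finset.sum_ite_eq', if_pos (Finset.mem_Ioo.2 ⟨h₁, h₂⟩)]
  have hlap : W₁ / 2 + W₂ / 2 = W - 1 := by rw [hW, hW₁, hW₂]; ring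
  have hγ : 4 / ((hi : ℝ) - lo) ^ 2 * W ≤ 1 := by
    rw [div_mul_eq_mul_div, div_le_one (by nlinarith), hW]
    nlinarith [sq_nonneg ((j - lo : ℝ) - (hi - j))]
  calc ∑ i ∈ Finset.Ioo lo hi, b i ≤ _ := Finset.sum_le_sum hpt
    _ = (Finset.Ioo lo hi).card * (M * W) - M * W +
        ∑ i ∈ Finset.Ioo lo hi, (if i = j + 1 then M * W₁ / 2 else 0) +
        ∑ i ∈ Finset.Ioo lo hi, (if i = j - 1 then M * W₂ / 2 else 0) := by
      rw [Finset.sum_add_distrib, Finset.sum_add_distrib, Finset.sum_sub_distrib, hj,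
        Finset.sum_const, nsmul_eq_mul]
    _ ≤ (Finset.Ioo lo hi).card * (M * W) - M * W + M * W₁ / 2 + M * W₂ / 2 := by
      have := hind (j + 1) (M * W₁ / 2) (by positivity)
      have := hind (j - 1) (M * W₂ / 2) (by positivity)
      linarith
    _ = (Finset.Ioo lo hi).card * (M * W) - M := by linear_combination M * hlap
    _ ≤ _ := by nlinarith

/-- The spectral gap of block dynamics whose blocks are arranged in a line. -/
lemma ladder_gap (hU : U ⊆ inner R) (idx : ℤ × ℤ → ℤ) {lo hi : ℤ}
    (hidx : ∀ z ∈ U, lo < idx z ∧ idx z < hi)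
    (hadj : ∀ v ∈ U, ∀ w ∈ U, triLattice.Adj v w →
      idx w = idx v ∨ idx w = idx v + 1 ∨ idx w = idx v - 1)
    (hcoup : ∀ v ∈ U, ∀ i, i = idx v + 1 ∨ i = idx v - 1 → ∀ (f : HeightFun R h → ℝ) (δ ε : ℝ),
      0 ≤ δ →
      (∀ z ∈ U.filter (fun z => idx z = i), ∀ F F', (agree R h {z}).r F F' → |f F' - f F| ≤ δ) →
      (∀ F F', (agree R h {v}).r F F' → |f F' - f F| ≤ ε) →
      ∀ H₁ H₂, (agree R h {v}).r H₁ H₂ →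
      |cexp (agree R h (U.filter fun z => idx z = i)) f H₂ -
        cexp (agree R h (U.filter fun z => idx z = i)) f H₁| ≤ ε + δ / 2)
    (f : HeightFun R h → ℝ) :
    4 / ((hi : ℝ) - lo) ^ 2 * sqn (f - cexp (agree R h U) f) ≤
      ∑ j ∈ Finset.Ioo lo hi, sqn (f - cexp (agree R h (U.filter fun z => idx z = j)) f) := by
  have hwpos : ∀ v ∈ U, (0 : ℝ) < ((idx v : ℝ) - lo) * (hi - idx v) := fun v hv => by
    obtain ⟨a, b⟩ := hidx v hv
    have a' : (lo : ℝ) < idx v := by exact_mod_cast a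
    have b' : (idx v : ℝ) < hi := by exact_mod_cast b
    exact mul_pos (by linarith) (by linarith)
  refine gap_of_contraction (fun v => (agree R h {v}).r) U
    (fun v => ((idx v : ℝ) - lo) * (hi - idx v)) hwpos _ _ _
    (fun j _ => agree_mono (Finset.filter_subset _ _)) _
    (fun f hf => cexp_agree_eq_self hU hf) ?_ f
  intro f M hM hf v hv H₁ H₂ h₁₂
  obtain ⟨a, b⟩ := hidx v hv
  refine (Finset.abs_sum_le_sum_abs _ _).trans (ladder_weight_sum a b hM ?_ ?_ ?_)
  · have : (agree R h {v}) ≤ agree R h (U.filter fun z => idx z = idx v) :=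
      agree_mono (Finset.singleton_subset_iff.2 (Finset.mem_filter.2 ⟨hv, rfl⟩))
    rw [cexp_congr f (this h₁₂), sub_self, abs_zero]
  · intro i hi'
    -- A neighbour of an index strictly between `lo` and `hi` may be an endpoint, where the weight
    -- vanishes and is still nonnegative.
    by_cases hmem : lo ≤ i ∧ i ≤ hi
    · refine hcoup v hv i hi' f _ _ ?_ (fun z hz F F' e => ?_) (fun F F' e => hf v hv F F' e) H₁ H₂ h₁₂
      · have h1 : (lo : ℝ) ≤ i := by exact_mod_cast hmem.1
        have h2 : (i : ℝ) ≤ hi := by exact_mod_cast hmem.2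
        exact mul_nonneg hM (mul_nonneg (by linarith) (by linarith))
      · obtain ⟨hzU, hzi⟩ := Finset.mem_filter.1 hz
        simpa only [hzi] using hf z hzU F F' e
    · omega
  · intro i h1 h2 h3
    refine abs_cexp_sub_cexp_le_of_not_adj (hU hv) (fun hvi => ?_) (fun w hw e => ?_)
      (fun F F' e => hf v hv F F' e) h₁₂
    · exact h1 (Finset.mem_filter.1 hvi).2.symm
    · obtain ⟨hwU, hwi⟩ := Finset.mem_filter.1 hw
      have := hadj v hv w hwU e
      omega

lemma adj_iff_of_adj {v w : ℤ × ℤ} (e : triLattice.Adj v w) :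
    (w.1 = v.1 ∨ w.1 = v.1 + 1 ∨ w.1 = v.1 - 1) ∧ (w.2 = v.2 ∨ w.2 = v.2 + 1 ∨ w.2 = v.2 - 1) := by
  simp only [triLattice, Prod.ext_iff, Prod.fst_sub, Prod.snd_sub] at e
  omega

/-- The spectral gap of the dynamics that resamples one column at a time. -/
lemma column_gap {x₀ x₁ : ℤ} (hx : ∀ z ∈ inner R, x₀ < z.1 ∧ z.1 < x₁) (f : HeightFun R h → ℝ) :
    4 / ((x₁ : ℝ) - x₀) ^ 2 * sqn (f - cexp (agree R h (inner R)) f) ≤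
      ∑ x ∈ Finset.Ioo x₀ x₁, sqn (f - cexp (agree R h ((inner R).filter fun z => z.1 = x)) f) := by
  refine ladder_gap (Finset.Subset.refl _) Prod.fst hx
    (fun v _ w _ e => (adj_iff_of_adj e).1) ?_ f
  rintro ⟨x, y⟩ hv i hi f δ ε hδ hf hε H₁ H₂ h₁₂
  rcases hi with rfl | rfl
  · exact abs_cexp_sub_cexp_le_of_column_right (Finset.filter_subset _ _)
      (fun z hz => (Finset.mem_filter.1 hz).2) hδ hf hv hε h₁₂
  · exact abs_cexp_sub_cexp_le_of_column_left (Finset.filter_subset _ _)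
      (fun z hz => (Finset.mem_filter.1 hz).2) hδ hf hv hε h₁₂

/-- The spectral gap of single-site dynamics inside a column. -/
lemma site_gap {y₀ y₁ : ℤ} (hy : ∀ z ∈ inner R, y₀ < z.2 ∧ z.2 < y₁) (x : ℤ)
    (f : HeightFun R h → ℝ) :
    4 / ((y₁ : ℝ) - y₀) ^ 2 * sqn (f - cexp (agree R h ((inner R).filter fun z => z.1 = x)) f) ≤
      ∑ y ∈ Finset.Ioo y₀ y₁,
        sqn (f - cexp (agree R h (((inner R).filter fun z => z.1 = x).filter fun z => z.2 = y)) f) := by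
  refine ladder_gap (Finset.filter_subset _ _) Prod.snd
    (fun z hz => hy z (Finset.mem_filter.1 hz).1) (fun v _ w _ e => (adj_iff_of_adj e).2) ?_ f
  rintro ⟨x', y⟩ hv i hi f δ ε hδ hf hε H₁ H₂ h₁₂
  obtain ⟨hvR, hx⟩ := Finset.mem_filter.1 hv
  obtain rfl : x' = x := hx
  simp only at hi
  by_cases hu : (x', i) ∈ inner R
  · have hset : ((inner R).filter fun z => z.1 = x').filter (fun z => z.2 = i) = {(x', i)} := by
      ext z
      simp only [Finset.mem_filter, Finset.mem_singleton, Prod.ext_iff]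
      constructor
      · rintro ⟨⟨-, e⟩, e'⟩
        exact ⟨e, e'⟩
      · rintro ⟨e, e'⟩
        exact ⟨⟨by rwa [show z = (x', i) from Prod.ext e e'], e⟩, e'⟩
    rw [hset] at hf ⊢
    exact abs_cexp_sub_cexp_le_of_vertical hi hu hvR (hf _ (Finset.mem_singleton_self _)) hε h₁₂
  · have hset : ((inner R).filter fun z => z.1 = x').filter (fun z => z.2 = i) = ∅ := by
      ext z
      simp only [Finset.mem_filter, Finset.notMem_empty, iff_false]
      rintro ⟨⟨e0, e⟩, e'⟩
      exact hu (by rwa [show z = (x', i) from Prod.ext e e'] at e0)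
    rw [hset]
    have := abs_cexp_sub_cexp_le_of_not_adj (U := ∅) hvR (by simp) (by simp) hε h₁₂
    linarith

/-- A Poincaré inequality for the single-site dynamics, in terms of the largest term. -/
lemma sqn_le_of_forall_site {x₀ x₁ y₀ y₁ : ℤ} (hx01 : x₀ < x₁) (hy01 : y₀ < y₁)
    (hx : ∀ z ∈ inner R, x₀ < z.1 ∧ z.1 < x₁) (hy : ∀ z ∈ inner R, y₀ < z.2 ∧ z.2 < y₁)
    (f : HeightFun R h → ℝ) {c : ℝ} (hc : 0 ≤ c)
    (hfc : ∀ z ∈ inner R, sqn (f - cexp (agree R h {z}) f) ≤ c) :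
    16 * sqn (f - cexp (agree R h (inner R)) f) ≤
      (((x₁ : ℝ) - x₀) * (y₁ - y₀)) ^ 3 * c := by
  have hsite : ∀ x y, sqn (f - cexp (agree R h
      (((inner R).filter fun z => z.1 = x).filter fun z => z.2 = y)) f) ≤ c := by
    intro x y
    by_cases hu : (x, y) ∈ inner R
    · refine (sqn_sub_cexp_mono _ _ f (agree_mono ?_)).trans (hfc _ hu)
      intro z hz
      simp only [Finset.mem_filter] at hz
      exact Finset.mem_singleton.2 (Prod.ext hz.1.2 hz.2)
    · have hset : ((inner R).filter fun z => z.1 = x).filter (fun z => z.2 = y) = ∅ := by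
        ext z
        simp only [Finset.mem_filter, Finset.notMem_empty, iff_false]
        rintro ⟨⟨e0, e⟩, e'⟩
        exact hu (by rwa [show z = (x, y) from Prod.ext e e'] at e0)
      rw [hset, cexp_agree_eq_self (by simp) (by simp), sub_self]
      simpa [sqn] using hc
  have hX : (0 : ℝ) < (x₁ : ℝ) - x₀ := sub_pos.2 (by exact_mod_cast hx01)
  have hY : (0 : ℝ) < (y₁ : ℝ) - y₀ := sub_pos.2 (by exact_mod_cast hy01)
  have hcard : ∀ a b : ℤ, a < b → ((Finset.Ioo a b).card : ℝ) ≤ b - a := by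
    intro a b hab
    rw [Int.card_Ioo]
    have : (((b - a - 1).toNat : ℤ) : ℝ) ≤ ((b - a : ℤ) : ℝ) := by
      exact_mod_cast (by omega : ((b - a - 1).toNat : ℤ) ≤ b - a)
    push_cast at this
    exact_mod_cast this
  have hcol : ∀ x, 4 * sqn (f - cexp (agree R h ((inner R).filter fun z => z.1 = x)) f) ≤
      ((y₁ : ℝ) - y₀) ^ 3 * c := by
    intro x
    -- In each coordinate the inverse gap contributes a square and the number of blocks one more
    -- factor, whence the cubes.
    have h1 := (site_gap hy x f).trans (Finset.sum_le_card_nsmul _ _ c fun y _ => hsite x y)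
    rw [nsmul_eq_mul, div_mul_eq_mul_div, div_le_iff₀ (by positivity)] at h1
    refine h1.trans ?_
    have := mul_le_mul_of_nonneg_right (hcard _ _ hy01) (mul_nonneg hc (sq_nonneg ((y₁ : ℝ) - y₀)))
    nlinarith
  have h1 := (column_gap hx f).trans (Finset.sum_le_card_nsmul _ _ (((y₁ : ℝ) - y₀) ^ 3 * c / 4)
    fun x _ => by linarith [hcol x])
  rw [nsmul_eq_mul, div_mul_eq_mul_div, div_le_iff₀ (by positivity)] at h1
  have h2 : (0 : ℝ) ≤ ((y₁ : ℝ) - y₀) ^ 3 * c / 4 * (((x₁ : ℝ) - x₀) ^ 2) := by positivity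
  have h3 := mul_le_mul_of_nonneg_right (hcard _ _ hx01) h2
  calc 16 * sqn (f - cexp (agree R h (inner R)) f)
      ≤ 4 * (((x₁ : ℝ) - x₀) * (((y₁ : ℝ) - y₀) ^ 3 * c / 4 * (((x₁ : ℝ) - x₀) ^ 2))) := by
        linarith
    _ = _ := by ring

end Ladder

/-! ## The resampling step as a conditional expectation -/

section Chain

variable {S : Type} [Fintype S]

/-- The real-valued probability mass function. -/
def dens (p : PMF S) (s : S) : ℝ := (p s).toReal

omit [Fintype S] in
lemma dens_injective : Function.Injective (dens : PMF S → S → ℝ) := by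
  intro p q e
  ext s
  exact (ENNReal.toReal_eq_toReal_iff' (p.apply_ne_top s) (q.apply_ne_top s)).1 (congrFun e s)

omit [Fintype S] in
lemma dens_nonneg (p : PMF S) (s : S) : 0 ≤ dens p s := ENNReal.toReal_nonneg

lemma sum_dens (p : PMF S) : ∑ s, dens p s = 1 := by
  have := p.tsum_coe
  rw [tsum_fintype] at this
  simp only [dens]
  rw [← ENNReal.toReal_sum fun s _ => p.apply_ne_top s, this, ENNReal.toReal_one]

lemma dens_bind (p : PMF S) (M : S → PMF S) (s : S) :
    dens (p.bind M) s = ∑ a, dens p a * dens (M a) s := by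
  simp only [dens]
  rw [PMF.bind_apply, tsum_fintype,
    ENNReal.toReal_sum fun a _ => ENNReal.mul_ne_top (p.apply_ne_top a) ((M a).apply_ne_top s)]
  simp only [ENNReal.toReal_mul]

lemma dens_uniform [Nonempty S] (s : S) :
    dens (PMF.uniformOfFintype S) s = (Fintype.card S : ℝ)⁻¹ := by
  simp [dens]

lemma dTV_sq_le (ν ρ : PMF S) : dTV ν ρ ^ 2 ≤ Fintype.card S * sqn (dens ν - dens ρ) := by
  have hsq : (∑ s, |dens ν s - dens ρ s|) ^ 2 ≤ Fintype.card S * sqn (dens ν - dens ρ) := by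
    have := sq_sum_le_card_mul_sum_sq (s := Finset.univ) (f := fun s => |dens ν s - dens ρ s|)
    simpa [sqn, sq_abs] using this
  have htoReal : ∀ (p : PMF S) (B : Set S),
      (p.toOuterMeasure B).toReal = ∑ s, B.indicator (dens p) s := by
    intro p B
    rw [PMF.toOuterMeasure_apply_fintype, ENNReal.toReal_sum]
    · refine Finset.sum_congr rfl fun s _ => ?_
      by_cases hs : s ∈ B <;> simp [hs, dens]
    · intro s _
      by_cases hs : s ∈ B <;> simp [hs, p.apply_ne_top s]
  have hB : ∀ B : Set S, |(ν.toOuterMeasure B).toReal - (ρ.toOuterMeasure B).toReal| ≤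
      ∑ s, |dens ν s - dens ρ s| := by
    intro B
    rw [htoReal, htoReal, ← Finset.sum_sub_distrib]
    refine (Finset.abs_sum_le_sum_abs _ _).trans (Finset.sum_le_sum fun s _ => ?_)
    by_cases hs : s ∈ B <;> simp [hs]
  have h0 : 0 ≤ dTV ν ρ := Real.iSup_nonneg fun _ => abs_nonneg _
  exact (pow_le_pow_left₀ h0 (ciSup_le hB) 2).trans hsq

/-- The squared distance is `∑ p ^ 2 - 1 / N`, with `N` the number of states, and `p ^ 2 ≤ p`. -/
lemma sqn_dens_sub_uniform_le [Nonempty S] (p : PMF S) :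
    sqn (dens p - dens (PMF.uniformOfFintype S)) ≤ 1 := by
  have hc : (0 : ℝ) < Fintype.card S := by exact_mod_cast Fintype.card_pos
  have h1 : ∀ s, dens p s ≤ 1 := fun s => by
    rw [← sum_dens p]
    exact Finset.single_le_sum (f := dens p) (fun s _ => dens_nonneg p s) (Finset.mem_univ s)
  have hpt : ∀ s, (dens p s - (Fintype.card S : ℝ)⁻¹) ^ 2 ≤
      dens p s - 2 * (Fintype.card S : ℝ)⁻¹ * dens p s + (Fintype.card S : ℝ)⁻¹ ^ 2 := fun s => by
    nlinarith [h1 s, dens_nonneg p s]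
  calc sqn (dens p - dens (PMF.uniformOfFintype S))
      = ∑ s, (dens p s - (Fintype.card S : ℝ)⁻¹) ^ 2 := by
        simp only [sqn, Pi.sub_apply, dens_uniform]
    _ ≤ ∑ s, (dens p s - 2 * (Fintype.card S : ℝ)⁻¹ * dens p s + (Fintype.card S : ℝ)⁻¹ ^ 2) :=
        Finset.sum_le_sum fun s _ => hpt s
    _ = 1 - (Fintype.card S : ℝ)⁻¹ := by
        rw [Finset.sum_add_distrib, Finset.sum_sub_distrib, ← Finset.mul_sum, sum_dens,
          Finset.sum_const, Finset.card_univ, nsmul_eq_mul]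
        field_simp
        ring
    _ ≤ 1 := by have := inv_pos.2 hc; linarith

variable {R Q : Finset (ℤ × ℤ)} {h : boundary R → ℤ}

lemma ht_glue (hQ : Q ⊆ R) (H : HeightFun R h) (F : HeightFun Q (boundaryRestrict hQ H))
    {z : ℤ × ℤ} (hz : z ∈ Q) : ht (glue hQ H F) z = F.1 ⟨z, hz⟩ := by
  rw [ht_of_mem _ (hQ hz)]
  exact dif_pos hz

lemma agree_glue (hQ : Q ⊆ R) (H : HeightFun R h) (F : HeightFun Q (boundaryRestrict hQ H)) :
    (agree R h (inner Q)).r H (glue hQ H F) := by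
  intro z hz
  by_cases hzQ : z ∈ Q
  · have hb : z ∈ boundary Q := by
      by_contra hb
      exact hz (Finset.mem_sdiff.2 ⟨hzQ, hb⟩)
    rw [ht_glue hQ H F hzQ, F.2.2 ⟨z, hb⟩, ht_of_mem _ (hQ hzQ)]
    rfl
  · by_cases hzR : z ∈ R
    · rw [ht_of_mem _ hzR, ht_of_mem _ hzR]
      exact (dif_neg hzQ : glueFun H F.1 ⟨z, hzR⟩ = H.1 ⟨z, hzR⟩).symm
    · simp only [ht, dif_neg hzR]

lemma glue_injective (hQ : Q ⊆ R) (H : HeightFun R h) : Function.Injective (glue hQ H) := by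
  intro F F' e
  refine Subtype.ext (funext fun z => ?_)
  rw [← ht_glue hQ H F z.2, ← ht_glue hQ H F' z.2, e]

lemma exists_glue_eq (hQ : Q ⊆ R) {H H' : HeightFun R h}
    (e : (agree R h (inner Q)).r H H') : ∃ F, glue hQ H F = H' := by
  obtain ⟨F, hF⟩ : ∃ F : HeightFun Q (boundaryRestrict hQ H), ∀ v, F.1 v = H'.1 ⟨v, hQ v.2⟩ := by
    refine ⟨⟨fun v => H'.1 ⟨v, hQ v.2⟩, fun _ _ huv => H'.2.1 _ _ huv, fun v => ?_⟩, fun _ => rfl⟩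
    have := e v fun hv => (Finset.mem_sdiff.1 hv).2 v.2
    rw [ht_of_mem _ (hQ (boundary_subset Q v.2)), ht_of_mem _ (hQ (boundary_subset Q v.2))] at this
    exact this.symm
  refine ⟨F, ht_injective (funext fun z => ?_)⟩
  by_cases hz : z ∈ Q
  · rw [ht_glue hQ H F hz, hF, ht_of_mem _ (hQ hz)]
  · have hz' : z ∉ inner Q := fun hz' => hz (inner_subset hz')
    rw [← agree_glue hQ H F z hz', e z hz']

/-- With injectivity of gluing, this identifies a uniform filling of `Q` with a uniform element of
the class of `H`. -/
lemma image_glue (hQ : Q ⊆ R) (H : HeightFun R h) :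
    Finset.univ.image (glue hQ H) = cls (agree R h (inner Q)) H := by
  ext H'
  rw [Finset.mem_image, mem_cls]
  constructor
  · rintro ⟨F, -, rfl⟩
    exact agree_glue hQ H F
  · intro e
    obtain ⟨F, hF⟩ := exists_glue_eq hQ e
    exact ⟨F, Finset.mem_univ _, hF⟩

lemma dens_resample (hQ : Q ⊆ R) (H H' : HeightFun R h) :
    dens (resample hQ H) H' =
      if (agree R h (inner Q)).r H' H then ((cls (agree R h (inner Q)) H').card : ℝ)⁻¹ else 0 := by
  rw [dens, resample, PMF.map_apply]
  split_ifs with e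
  · obtain ⟨F, rfl⟩ := exists_glue_eq hQ ((agree R h _).iseqv.symm e)
    rw [tsum_eq_single F fun F' hF' => if_neg fun e' => hF' (glue_injective hQ H e').symm, if_pos rfl,
      PMF.uniformOfFintype_apply, cls_congr e, ← image_glue hQ H,
      Finset.card_image_of_injective _ (glue_injective hQ H), Finset.card_univ]
    simp
  · rw [ENNReal.tsum_eq_zero.2 fun F => if_neg fun e' => e ?_, ENNReal.toReal_zero]
    rw [e']
    exact (agree R h _).iseqv.symm (agree_glue hQ H F)

/-- A resampling step averages the density. -/
lemma dens_bind_resample (hQ : Q ⊆ R) (p : PMF (HeightFun R h)) :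
    dens (p.bind (resample hQ)) = cexp (agree R h (inner Q)) (dens p) := by
  ext H'
  rw [dens_bind, cexp, ave, Finset.sum_div]
  simp only [dens_resample, mul_ite, mul_zero]
  rw [cls, Finset.sum_filter]
  simp only [div_eq_mul_inv]

variable [Nonempty (HeightFun R h)]

lemma cexp_dens_uniform (r : Setoid (HeightFun R h)) :
    cexp r (dens (PMF.uniformOfFintype (HeightFun R h))) =
      dens (PMF.uniformOfFintype (HeightFun R h)) :=
  cexp_eq_self fun _ _ _ => by rw [dens_uniform, dens_uniform]

variable {k : ℕ} (hk : 1 ≤ k) (P : Fin k → Finset (ℤ × ℤ)) (hP : ∀ i, P i ⊆ R)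

/-- The deviation of the density at time `t` from the uniform one. -/
def deviation (ν : PMF (HeightFun R h)) (t : ℕ) : HeightFun R h → ℝ :=
  dens (lawAt (alternating hk P hP) ν t) - dens (PMF.uniformOfFintype (HeightFun R h))

lemma deviation_succ (ν : PMF (HeightFun R h)) (t : ℕ) :
    deviation hk P hP ν (t + 1) =
      cexp (agree R h (inner (P ⟨t % k, Nat.mod_lt _ hk⟩))) (deviation hk P hP ν t) := by
  rw [deviation, deviation, cexp_sub, cexp_dens_uniform]
  congr 1
  exact dens_bind_resample (hP ⟨t % k, Nat.mod_lt _ hk⟩) _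

/-- All of `𝒢(h)` agrees off the interior, so there is a single class, and a difference of two
probability densities has mean zero. -/
lemma cexp_inner_deviation (ν : PMF (HeightFun R h)) (t : ℕ) :
    cexp (agree R h (inner R)) (deviation hk P hP ν t) = 0 := by
  ext H
  have hcls : cls (agree R h (inner R)) H = Finset.univ := by
    ext H'
    simp only [mem_cls, Finset.mem_univ, iff_true]
    exact fun z hz => ht_eq_of_notMem_inner H H' hz
  rw [cexp, ave, hcls]
  simp only [deviation, Pi.sub_apply, Finset.sum_sub_distrib, sum_dens, sub_self, zero_div,
    Pi.zero_apply]

end Chain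

/-! ## Diameter bounds -/

section Diameter

variable {R : Finset (ℤ × ℤ)}

lemma latticeDiam_nonneg : 0 ≤ latticeDiam R := Metric.diam_nonneg

lemma sub_le_latticeDiam {u v : ℤ × ℤ} (hu : u ∈ R) (hv : v ∈ R) :
    (u.1 : ℝ) - v.1 ≤ latticeDiam R ∧ (u.2 : ℝ) - v.2 ≤ latticeDiam R := by
  set e : ℤ × ℤ → EuclideanSpace ℝ (Fin 2) := fun v => !₂[(v.1 : ℝ), (v.2 : ℝ)]
  have hd : dist (e u) (e v) ≤ latticeDiam R :=
    Metric.dist_le_diam_of_mem (R.finite_toSet.image e).isBounded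
      (Set.mem_image_of_mem e hu) (Set.mem_image_of_mem e hv)
  rw [dist_eq_norm] at hd
  have h0 := (PiLp.norm_apply_le (e u - e v) 0).trans hd
  have h1 := (PiLp.norm_apply_le (e u - e v) 1).trans hd
  simp only [e, PiLp.sub_apply, Real.norm_eq_abs] at h0 h1
  exact ⟨(le_abs_self _).trans (by simpa using h0), (le_abs_self _).trans (by simpa using h1)⟩

/-- A bounding box. -/
lemma exists_box (hR : R.Nonempty) : ∃ x₀ x₁ y₀ y₁ : ℤ,
    (∀ z ∈ R, (x₀ ≤ z.1 ∧ z.1 ≤ x₁) ∧ (y₀ ≤ z.2 ∧ z.2 ≤ y₁)) ∧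
    ((x₁ : ℝ) - x₀ ≤ latticeDiam R ∧ (y₁ : ℝ) - y₀ ≤ latticeDiam R) := by
  obtain ⟨a, ha, ha'⟩ := R.exists_min_image Prod.fst hR
  obtain ⟨b, hb, hb'⟩ := R.exists_max_image Prod.fst hR
  obtain ⟨c, hc, hc'⟩ := R.exists_min_image Prod.snd hR
  obtain ⟨d, hd, hd'⟩ := R.exists_max_image Prod.snd hR
  exact ⟨a.1, b.1, c.2, d.2, fun z hz => ⟨⟨ha' z hz, hb' z hz⟩, hc' z hz, hd' z hz⟩,
    (sub_le_latticeDiam hb ha).1, (sub_le_latticeDiam hd hc).2⟩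

lemma card_le_latticeDiam : (R.card : ℝ) ≤ (latticeDiam R + 1) ^ 2 := by
  rcases R.eq_empty_or_nonempty with rfl | hR
  · simpa using sq_nonneg _
  obtain ⟨x₀, x₁, y₀, y₁, hbox, hx, hy⟩ := exists_box hR
  obtain ⟨z, hz⟩ := hR
  have hsub : R ⊆ Finset.Icc x₀ x₁ ×ˢ Finset.Icc y₀ y₁ := fun z hz => by
    simpa [and_assoc] using hbox z hz
  have hc := Finset.card_le_card hsub
  rw [Finset.card_product, Int.card_Icc, Int.card_Icc] at hc
  have hzb := hbox z hz
  have e : ∀ a b : ℤ, a ≤ b → (((b + 1 - a).toNat : ℕ) : ℝ) = b + 1 - a := fun a b hab => by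
    have : (((b + 1 - a).toNat : ℤ) : ℝ) = ((b + 1 - a : ℤ) : ℝ) := by
      rw [Int.toNat_of_nonneg (by omega)]
    push_cast at this
    exact_mod_cast this
  have hx01 : x₀ ≤ x₁ := by omega
  have hy01 : y₀ ≤ y₁ := by omega
  have hx' : (x₀ : ℝ) ≤ x₁ := by exact_mod_cast hx01
  have hy' : (y₀ : ℝ) ≤ y₁ := by exact_mod_cast hy01
  calc (R.card : ℝ) ≤ (((x₁ + 1 - x₀).toNat * (y₁ + 1 - y₀).toNat : ℕ) : ℝ) := by exact_mod_cast hc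
    _ = (x₁ + 1 - x₀) * (y₁ + 1 - y₀) := by rw [Nat.cast_mul, e _ _ hx01, e _ _ hy01]
    _ ≤ (latticeDiam R + 1) * (latticeDiam R + 1) :=
        mul_le_mul (by linarith) (by linarith) (by linarith) (by linarith [latticeDiam_nonneg (R := R)])
    _ = _ := by ring

variable {h : boundary R → ℤ}

/-- One bit per vertex, recording whether the step in direction `(1, 0)` is flat, determines the
heights from right to left, starting from the fixed values off the interior. -/
lemma card_heightFun_le : Fintype.card (HeightFun R h) ≤ 2 ^ R.card := by
  rw [← Finset.card_powerset, ← Finset.card_univ]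
  refine Finset.card_le_card_of_injOn
    (fun H => R.filter fun z => ht H (z.1 + 1, z.2) = ht H z)
    (fun H _ => Finset.mem_coe.2 (Finset.mem_powerset.2 (Finset.filter_subset _ _))) ?_
  intro H _ H' _ e
  obtain ⟨M, hM⟩ : ∃ M : ℤ, ∀ v ∈ R, v.1 ≤ M := by
    obtain ⟨M, hM⟩ := (R.image Prod.fst).bddAbove
    exact ⟨M, fun v hv => hM (by simpa using ⟨v.2, hv⟩)⟩
  have key : ∀ n : ℕ, ∀ z : ℤ × ℤ, (M + 1 - z.1).toNat ≤ n → ht H z = ht H' z := by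
    intro n
    induction n with
    | zero =>
      intro z hz
      refine ht_eq_of_notMem_inner H H' fun hzi => ?_
      have := hM z (inner_subset hzi)
      omega
    | succ n ih =>
      rintro ⟨x, y⟩ hz
      by_cases hzi : (x, y) ∈ inner R
      · have hr := ih (x + 1, y) (by simp only at hz ⊢; omega)
        have a := (fits_self H hzi).right
        have b := (fits_self H' hzi).right
        have hbit : ht H (x + 1, y) = ht H (x, y) ↔ ht H' (x + 1, y) = ht H' (x, y) := by
          have := Finset.ext_iff.1 e (x, y)
          simpa [inner_subset hzi] using this
        omega
      · exact ht_eq_of_notMem_inner H H' hzi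
  exact ht_injective (funext fun z => key _ z le_rfl)

lemma sqn_le_of_forall_site_of_diam (f : HeightFun R h → ℝ) {c : ℝ} (hc : 0 ≤ c)
    (hfc : ∀ z ∈ inner R, sqn (f - cexp (agree R h {z}) f) ≤ c) :
    16 * sqn (f - cexp (agree R h (inner R)) f) ≤ (latticeDiam R ^ 2) ^ 3 * c := by
  rcases (inner R).eq_empty_or_nonempty with he | ⟨⟨x, y⟩, hz⟩
  · have : f - cexp (agree R h (inner R)) f = 0 := by
      rw [cexp_agree_eq_self (Finset.Subset.refl _) (by simp [he]), sub_self]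
    rw [this]
    have h0 : sqn (0 : HeightFun R h → ℝ) = 0 := by simp [sqn]
    rw [h0, mul_zero]
    positivity
  obtain ⟨x₀, x₁, y₀, y₁, hbox, hx, hy⟩ := exists_box ⟨_, inner_subset hz⟩
  have hin : ∀ z ∈ inner R, (x₀ < z.1 ∧ z.1 < x₁) ∧ (y₀ < z.2 ∧ z.2 < y₁) := by
    rintro ⟨x, y⟩ hz
    obtain ⟨-, -, h3, -, -, h6⟩ := neighbours_mem hz
    have a := hbox _ h3
    have b := hbox _ h6
    simp only at a b ⊢
    omega
  have hzb := hin _ hz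
  have hx01 : x₀ < x₁ := by omega
  have hy01 : y₀ < y₁ := by omega
  have hx' : (x₀ : ℝ) < x₁ := by exact_mod_cast hx01
  have hy' : (y₀ : ℝ) < y₁ := by exact_mod_cast hy01
  refine (sqn_le_of_forall_site hx01 hy01 (fun z hz => (hin z hz).1) (fun z hz => (hin z hz).2)
    f hc hfc).trans ?_
  have hprod : ((x₁ : ℝ) - x₀) * (y₁ - y₀) ≤ latticeDiam R ^ 2 := by
    rw [sq]
    exact mul_le_mul hx hy (by linarith) latticeDiam_nonneg
  have h0 : 0 ≤ ((x₁ : ℝ) - x₀) * (y₁ - y₀) := mul_nonneg (by linarith) (by linarith)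
  exact mul_le_mul_of_nonneg_right (pow_le_pow_left₀ h0 hprod 3) hc

end Diameter

/-! ## Contraction of the alternating dynamics -/

section Mixing

variable {R : Finset (ℤ × ℤ)} {h : boundary R → ℤ} [Nonempty (HeightFun R h)]
  {k : ℕ} (hk : 1 ≤ k) (P : Fin k → Finset (ℤ × ℤ)) (hP : ∀ i, P i ⊆ R)

/-- Resampling a site moves the deviation no more than resampling a subdomain with that site in its
interior, and this is at most `k` times the loss of squared norm over the round. The Poincaré
inequality turns this into a proportional loss. -/
lemma sqn_deviation_round (hcover : ∀ v ∈ inner R, ∃ i, v ∈ inner (P i)) {A : ℝ}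
    (hA : A = latticeDiam R ^ 2) (hA0 : 0 < A) (ν : PMF (HeightFun R h)) (m : ℕ) :
    sqn (deviation hk P hP ν (k * (m + 1))) ≤
      Real.exp (-(16 / (A ^ 3 * k))) * sqn (deviation hk P hP ν (k * m)) := by
  have hk0 : (0 : ℝ) < k := by exact_mod_cast hk
  set F : ℕ → HeightFun R h → ℝ := fun i => deviation hk P hP ν (k * m + i) with hF
  have hstep : ∀ i < k, sqn (F 0 - cexp (agree R h (inner (P ⟨(k * m + i) % k, Nat.mod_lt _ hk⟩)))
      (F 0)) ≤ k * (sqn (F 0) - sqn (F k)) := fun i hi =>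
    sqn_sub_cexp_le_of_iterate
      (fun i => agree R h (inner (P ⟨(k * m + i) % k, Nat.mod_lt _ hk⟩))) F
      (fun i => deviation_succ hk P hP ν (k * m + i)) hi
  have hc : 0 ≤ k * (sqn (F 0) - sqn (F k)) := (sqn_nonneg _).trans (hstep 0 hk)
  have hgap := sqn_le_of_forall_site_of_diam (F 0) hc fun z hz => by
    obtain ⟨i, hi⟩ := hcover z hz
    have hmod : (⟨(k * m + i) % k, Nat.mod_lt _ hk⟩ : Fin k) = i := by
      refine Fin.ext ?_
      simp only [Nat.mul_add_mod, Nat.mod_eq_of_lt i.2]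
    have := hstep i i.2
    rw [hmod] at this
    exact (sqn_sub_cexp_mono _ _ _ (agree_mono (Finset.singleton_subset_iff.2 hi))).trans this
  have h0 : cexp (agree R h (inner R)) (F 0) = 0 := cexp_inner_deviation hk P hP ν _
  rw [h0, sub_zero, ← hA] at hgap
  have hexp := Real.add_one_le_exp (-(16 / (A ^ 3 * k)))
  have hle : sqn (F k) ≤ (1 - 16 / (A ^ 3 * k)) * sqn (F 0) := by
    have hpos : 0 < A ^ 3 * k := by positivity
    have : 16 / (A ^ 3 * k) * sqn (F 0) ≤ sqn (F 0) - sqn (F k) := by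
      rw [div_mul_eq_mul_div, div_le_iff₀ hpos]
      linarith
    linarith
  calc sqn (deviation hk P hP ν (k * (m + 1))) = sqn (F k) := by rw [hF, mul_add, mul_one]
    _ ≤ (1 - 16 / (A ^ 3 * k)) * sqn (F 0) := hle
    _ ≤ Real.exp (-(16 / (A ^ 3 * k))) * sqn (F 0) :=
        mul_le_mul_of_nonneg_right (by linarith) (sqn_nonneg _)

lemma sqn_deviation_le (hcover : ∀ v ∈ inner R, ∃ i, v ∈ inner (P i)) {A : ℝ}
    (hA : A = latticeDiam R ^ 2) (hA0 : 0 < A) (ν : PMF (HeightFun R h)) (m : ℕ) :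
    sqn (deviation hk P hP ν (k * m)) ≤ Real.exp (-(16 / (A ^ 3 * k) * m)) := by
  induction m with
  | zero => simpa [deviation, lawAt] using sqn_dens_sub_uniform_le ν
  | succ m ih =>
    refine (sqn_deviation_round hk P hP hcover hA hA0 ν m).trans ?_
    have e : Real.exp (-(16 / (A ^ 3 * k) * ((m + 1 : ℕ) : ℝ))) =
        Real.exp (-(16 / (A ^ 3 * k))) * Real.exp (-(16 / (A ^ 3 * k) * m)) := by
      rw [← Real.exp_add]
      congr 1
      push_cast
      ring
    rw [e]
    exact mul_le_mul_of_nonneg_left ih (Real.exp_pos _).le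

lemma lawAt_of_isStationary {S : Type} {M : ℕ → S → PMF S} {ρ : PMF S} (hρ : IsStationary M ρ)
    (t : ℕ) : lawAt M ρ t = ρ := by
  induction t with
  | zero => rfl
  | succ t ih => rw [lawAt, ih, hρ (t + 1) (by omega)]

lemma isStationary_iff (hcover : ∀ v ∈ inner R, ∃ i, v ∈ inner (P i)) {A : ℝ}
    (hA : A = latticeDiam R ^ 2) (hA0 : 0 < A) (ρ : PMF (HeightFun R h)) :
    IsStationary (alternating hk P hP) ρ ↔ ρ = PMF.uniformOfFintype (HeightFun R h) := by
  constructor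
  · intro hρ
    have hdev : ∀ t, deviation hk P hP ρ t =
        dens ρ - dens (PMF.uniformOfFintype (HeightFun R h)) := fun t => by
      rw [deviation, lawAt_of_isStationary hρ]
    -- The deviation of a stationary law is constant in time, so strict contraction over one round
    -- forces it to vanish.
    have hround := sqn_deviation_round hk P hP hcover hA hA0 ρ 0
    rw [hdev, hdev] at hround
    have hk0 : (0 : ℝ) < k := by exact_mod_cast hk
    have hlt : Real.exp (-(16 / (A ^ 3 * k))) < 1 := by
      rw [Real.exp_lt_one_iff, neg_lt_zero]
      positivity
    have hzero : sqn (dens ρ - dens (PMF.uniformOfFintype (HeightFun R h))) = 0 := by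
      have := sqn_nonneg (dens ρ - dens (PMF.uniformOfFintype (HeightFun R h)))
      nlinarith
    refine dens_injective (funext fun s => ?_)
    have := (Finset.sum_eq_zero_iff_of_nonneg fun s _ => sq_nonneg _).1 hzero s (Finset.mem_univ s)
    exact sub_eq_zero.1 (pow_eq_zero_iff two_ne_zero |>.1 this)
  · rintro rfl t _
    refine dens_injective ?_
    exact (dens_bind_resample (hP _) _).trans (cexp_dens_uniform _)

lemma dTV_lawAt_le (hcover : ∀ v ∈ inner R, ∃ i, v ∈ inner (P i)) {A : ℝ}
    (hA : A = latticeDiam R ^ 2) (hA1 : 1 ≤ A) (ν : PMF (HeightFun R h)) (m : ℕ) :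
    dTV (lawAt (alternating hk P hP) ν (k * m)) (PMF.uniformOfFintype (HeightFun R h)) ≤
      Real.exp ((4 * A - 16 / (A ^ 3 * k) * m) / 2) := by
  refine le_of_sq_le_sq ?_ (Real.exp_pos _).le
  have hD : 1 ≤ latticeDiam R := by
    have := latticeDiam_nonneg (R := R)
    nlinarith
  -- Here `2 ≤ exp 1`, and `(latticeDiam R + 1) ^ 2 ≤ 4 * A` because the diameter is at least `1`.
  have hcard : (Fintype.card (HeightFun R h) : ℝ) ≤ Real.exp (4 * A) := by
    calc (Fintype.card (HeightFun R h) : ℝ) ≤ ((2 ^ R.card : ℕ) : ℝ) := by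
          exact_mod_cast card_heightFun_le
      _ = 2 ^ R.card := by push_cast; rfl
      _ ≤ Real.exp 1 ^ R.card :=
          pow_le_pow_left₀ (by norm_num) (by linarith [Real.add_one_le_exp (1 : ℝ)]) _
      _ = Real.exp R.card := by rw [← Real.exp_nat_mul, mul_one]
      _ ≤ Real.exp (4 * A) := by
          refine Real.exp_le_exp.2 (card_le_latticeDiam.trans ?_)
          nlinarith
  refine (dTV_sq_le _ _).trans ?_
  calc _ ≤ Real.exp (4 * A) * Real.exp (-(16 / (A ^ 3 * k) * m)) :=
        mul_le_mul hcard (sqn_deviation_le hk P hP hcover hA (by linarith) ν m) (sqn_nonneg _)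
          (Real.exp_pos _).le
    _ = _ := by
        rw [← Real.exp_add, sq, ← Real.exp_add]
        congr 1
        ring

/-- With `⌊A ^ 6 / k⌋₊` rounds, `m / (A ^ 3 * k)` is at least `A - 1`. The exponent is then at most
`8 - 6 * A`, which is below `-A` for `A ≥ 2`. -/
lemma exists_rounds {A k : ℝ} (hA : 2 ≤ A) (hk : 1 ≤ k) (hkA : k ≤ A) :
    ∃ m : ℕ, k * m ≤ A ^ 6 ∧ (4 * A - 16 / (A ^ 3 * k) * m) / 2 < -A := by
  have hA0 : 0 < A := by linarith
  have hk0 : 0 < k := by linarith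
  refine ⟨⌊A ^ 6 / k⌋₊, ?_, ?_⟩
  · have := Nat.floor_le (by positivity : 0 ≤ A ^ 6 / k)
    rw [le_div_iff₀ hk0] at this
    linarith
  · have hm : A ^ 6 / k - 1 < ⌊A ^ 6 / k⌋₊ := Nat.sub_one_lt_floor _
    have h1 : A - 1 ≤ (A ^ 6 / k - 1) / (A ^ 3 * k) := by
      have e : (A ^ 6 / k - 1) / (A ^ 3 * k) = A ^ 3 / k ^ 2 - 1 / (A ^ 3 * k) := by
        field_simp
      have a : A ≤ A ^ 3 / k ^ 2 := by
        rw [le_div_iff₀ (by positivity)]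
        have : k ^ 2 ≤ A ^ 2 := pow_le_pow_left₀ hk0.le hkA 2
        nlinarith
      have b : 1 / (A ^ 3 * k) ≤ 1 := by
        rw [div_le_one (by positivity)]
        have : 1 ≤ A ^ 3 := one_le_pow₀ (by linarith)
        nlinarith
      rw [e]
      linarith
    have h2 : (A ^ 6 / k - 1) / (A ^ 3 * k) ≤ ⌊A ^ 6 / k⌋₊ / (A ^ 3 * k) := by gcongr
    have h3 : 16 / (A ^ 3 * k) * (⌊A ^ 6 / k⌋₊ : ℝ) = 16 * (⌊A ^ 6 / k⌋₊ / (A ^ 3 * k)) := by ring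
    rw [h3]
    linarith

end Mixing

end Lozenge

end

theorem proposition4p5 :
    ∃ C : ℝ, 1 < C ∧
      ∀ (R : Finset (ℤ × ℤ)) (h : Lozenge.boundary R → ℤ) [Nonempty (Lozenge.HeightFun R h)]
        (k : ℕ) (hk : 1 ≤ k) (Q : Fin k → Finset (ℤ × ℤ)) (hQ : ∀ i, Q i ⊆ R) (A : ℝ),
        Lozenge.IsLatticeDomain R →
        (∀ i, Lozenge.IsLatticeDomain (Q i)) →
        (∀ v ∈ R, ∃ i, v ∈ Q i) →
        (∀ v ∈ R \ Lozenge.boundary R, ∃ i, v ∈ Q i \ Lozenge.boundary (Q i)) →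
        A = Lozenge.latticeDiam R ^ 2 →
        C ≤ A →
        (k : ℝ) ≤ A →
        (∀ ρ : PMF (Lozenge.HeightFun R h),
          Lozenge.IsStationary (Lozenge.alternating hk Q hQ) ρ ↔
            ρ = PMF.uniformOfFintype (Lozenge.HeightFun R h)) ∧
        ∃ t : ℕ,
          Lozenge.mixingTime (Lozenge.alternating hk Q hQ)
            (PMF.uniformOfFintype (Lozenge.HeightFun R h)) (Real.exp (-A)) = t ∧
          (t : ℝ) ≤ A ^ 6 := by
  refine ⟨2, by norm_num, ?_⟩
  intro R h _ k hk Q hQ A _ _ _ hcover hA hA2 hkA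
  refine ⟨Lozenge.isStationary_iff hk Q hQ hcover hA (by linarith), ?_⟩
  obtain ⟨m, hm, hexp⟩ := Lozenge.exists_rounds hA2 (by exact_mod_cast hk : (1 : ℝ) ≤ k) hkA
  have hne : Nonempty (PMF (Lozenge.HeightFun R h)) := ⟨PMF.uniformOfFintype _⟩
  have hmix : Lozenge.mixingTime (Lozenge.alternating hk Q hQ)
      (PMF.uniformOfFintype (Lozenge.HeightFun R h)) (Real.exp (-A)) ≤ ((k * m : ℕ) : ℕ∞) :=
    -- The bound is uniform in the initial law, so it passes to the supremum, and strictness comes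
    -- from the strict inequality of the exponents.
    sInf_le ⟨k * m, rfl, (ciSup_le fun ν =>
      Lozenge.dTV_lawAt_le hk Q hQ hcover hA (by linarith) ν m).trans_lt (Real.exp_lt_exp.2 hexp)⟩
  obtain ⟨t, ht⟩ := ENat.ne_top_iff_exists.1 (ne_top_of_le_ne_top (ENat.natCast_ne_top _) hmix)
  refine ⟨t, ht.symm, le_trans ?_ hm⟩
  rw [← ht] at hmix
  exact_mod_cast hmix
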